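/- Let $\mathfrak g$ be a finite-dimensional semisimple complex Lie algebra with Cartan subalgebra $\mathfrak h$, root system $\Phi$ and a choice of simple roots, giving the triangular decomposition $\mathfrak g=\mathfrak n_-\oplus\mathfrak h\oplus\mathfrak n_+$. Let $(\cdot,\cdot)$ be the Killing form and let $$\hat{\mathfrak g}=(\mathfrak g\otimes\mathbb C[t,t^{-1}])\oplus\mathbb Cd\oplus\mathbb Cc$$ be the untwisted affine Lie algebra: $c$ is central, $[d,x\otimes t^i]=i\,x\otimes t^i$ and $$[x\otimes t^i,y\otimes t^j]=[x,y]\otimes t^{i+j}+i\,\delta_{i,-j}\,(x,y)\,c\qquad(x,y\in\mathfrak g,\ i,j\in\mathbb Z).$$ Let $\mathfrak p\neq\mathfrak g$ be a parabolic subalgebra containing $\mathfrak h\oplus\mathfrak n_+$, let $\mathfrak n$ be its nilradical (its largest nilpotent ideal), and let $L(\mathfrak n)=\mathfrak n\otimes\mathbb C[t,t^{-1}]$, a Lie subalgebra of $\hat{\mathfrak g}$. Let $\Phi_{\mathfrak n}^0$ be the set of all roots $\alpha$ with $\mathfrak g_\alpha\subseteq\mathfrak n$ and $\mathfrak g_\alpha\not\subseteq[\mathfrak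 n,\mathfrak n]$, and fix a non-zero $X_\alpha\in\mathfrak g_\alpha$ for every root $\alpha$. Let $\theta\in\mathbb C$ and let $\Lambda:\Phi_{\mathfrak n}^0\to\mathbb C^{\mathbb Z}$ be a map whose image, considered as a multiset, is strongly generic: the multiset of all translates $(\Lambda(\alpha)_{i+n})_{i\in\mathbb Z}$, for $\alpha\in\Phi_{\mathfrak n}^0$ and $n\in\mathbb Z$, together with the set of all elements $(i\,\Lambda(\alpha)_i)_{i\in\mathbb Z}$, for $\alpha\in\Phi_{\mathfrak n}^0$, is linearly independent in $\mathbb C^{\mathbb Z}$. Let $\mathbb C_\Lambda$ be the one-dimensional $L(\mathfrak n)$-module annihilated by $[L(\mathfrak n),L(\mathfrak n)]$ on which $X_\alpha\otimes t^j$ acts as the scalar $\Lambda(\alpha)_j$, for $\alpha\in\Phi_{\mathfrak n}^0$ and $j\in\mathbb Z$. Let $U_\theta$ be the quotient of $U(\hat{\mathfrak g})$ by the two-sided ideal generated by $c-\theta$, and regard $$M(\Lambda,\theta)=U_\theta\otimes_{U(L(\mathfrak n))}\mathbb C_\Lambda$$ as a $U(\hat{\mathfrak g})$-module. Then the complex vector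 space $$\mathrm{Ext}^1_{U(\hat{\mathfrak g})}\big(M(\Lambda,\theta),M(\Lambda,\theta)\big)$$ has uncountable dimension. -/

import Mathlib

open scoped TensorProduct

universe u

noncomputable section

namespace AffineWhittaker

open LieAlgebra LieAlgebra.IsKilling LieModule CategoryTheory

/-! ### The untwisted affine Lie algebra -/

section Affine

/-- The derivation `t d/dt` of the Laurent polynomials, that is `t ^ i ↦ i t ^ i`. -/
def eulerDerivation : Derivation ℂ (AddMonoidAlgebra ℂ ℤ) (AddMonoidAlgebra ℂ ℤ) :=
  Derivation.mk' ((AddMonoidAlgebra.basis ℤ ℂ).constr ℂ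
    fun i => (i : ℂ) • AddMonoidAlgebra.single i (1 : ℂ)) (by
    intro a b
    have key : ∀ i : ℤ, (AddMonoidAlgebra.basis ℤ ℂ).constr ℂ
        (fun i => (i : ℂ) • AddMonoidAlgebra.single i (1 : ℂ)) (AddMonoidAlgebra.single i 1) =
          (i : ℂ) • AddMonoidAlgebra.single i (1 : ℂ) := fun i => by
      rw [← AddMonoidAlgebra.basis_apply, Module.Basis.constr_basis, AddMonoidAlgebra.basis_apply]
    induction (AddMonoidAlgebra.basis ℤ ℂ).mem_span a using Submodule.span_induction with
    | zero => simp
    | add x y _ _ hx hy => rw [add_mul, map_add, hx, hy, map_add, add_smul, smul_add]; abel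
    | smul c x _ hx => rw [smul_mul_assoc, map_smul, hx, map_smul, smul_add, smul_assoc,
        smul_comm c b]
    | mem x hx =>
      obtain ⟨i, rfl⟩ := hx
      induction (AddMonoidAlgebra.basis ℤ ℂ).mem_span b using Submodule.span_induction with
      | zero => simp
      | add x y _ _ hx hy => rw [mul_add, map_add, hx, hy, map_add, add_smul, smul_add]; abel
      | smul c x _ hx => rw [mul_smul_comm, map_smul, hx, map_smul, smul_add, smul_assoc,
          smul_comm c]
      | mem x hx =>
        obtain ⟨j, rfl⟩ := hx
        simp only [AddMonoidAlgebra.basis_apply, AddMonoidAlgebra.single_mul_single, mul_one, key,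
          smul_eq_mul, mul_smul_comm, add_comm j i, ← add_smul]
        push_cast
        rw [add_comm])

theorem eulerDerivation_single (i : ℤ) :
    eulerDerivation (AddMonoidAlgebra.single i 1) = (i : ℂ) • AddMonoidAlgebra.single i (1 : ℂ) := by
  change (AddMonoidAlgebra.basis ℤ ℂ).constr ℂ
        (fun i => (i : ℂ) • AddMonoidAlgebra.single i (1 : ℂ)) (AddMonoidAlgebra.single i 1) = _
  rw [← AddMonoidAlgebra.basis_apply, Module.Basis.constr_basis, AddMonoidAlgebra.basis_apply]

variable (𝔤 : Type u) [LieRing 𝔤] [LieAlgebra ℂ 𝔤]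

/-- The loop algebra `L(𝔤) = 𝔤 ⊗ ℂ[t, t⁻¹]`. -/
def Loop : Type u := loopAlgebra ℂ ℤ 𝔤

instance : LieRing (Loop 𝔤) := inferInstanceAs (LieRing (loopAlgebra ℂ ℤ 𝔤))

instance : LieAlgebra ℂ (Loop 𝔤) := inferInstanceAs (LieAlgebra ℂ (loopAlgebra ℂ ℤ 𝔤))

/-- The derivation `x ⊗ t ^ i ↦ i (x ⊗ t ^ i)` of the loop algebra. -/
def loopDerivation : LieDerivation ℂ (Loop 𝔤) (Loop 𝔤) :=
  (Lie.Derivation.ofDerivation 𝔤 eulerDerivation :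
    LieDerivation ℂ (loopAlgebra ℂ ℤ 𝔤) (loopAlgebra ℂ ℤ 𝔤))

/-- The form `(x ⊗ t ^ i, y ⊗ t ^ j) ↦ i δ_{i,-j} (x, y)` on the loop algebra, where `(x, y)` is
the Killing form. -/
def affineCocycle : LinearMap.BilinForm ℂ (Loop 𝔤) :=
  ((LoopAlgebra.residuePairing ℂ ℤ 𝔤 (killingForm ℂ 𝔤)).flip :
    LinearMap.BilinForm ℂ (loopAlgebra ℂ ℤ 𝔤))

/-- The identification of `L(𝔤)` with the finitely supported functions `ℤ → 𝔤`: the value at `i`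
is the coefficient of `t ^ i`. -/
def Loop.coeffs : Loop 𝔤 ≃ₗ[ℂ] (ℤ →₀ 𝔤) := LoopAlgebra.toFinsupp ℂ ℤ 𝔤

variable {𝔤}

/-- The element `x ⊗ t ^ i` of the loop algebra. -/
def loopElt (x : 𝔤) (i : ℤ) : Loop 𝔤 :=
  (AddMonoidAlgebra.single i 1 ⊗ₜ x : loopAlgebra ℂ ℤ 𝔤)

theorem coeffs_loopElt (x : 𝔤) (i : ℤ) : Loop.coeffs 𝔤 (loopElt x i) = Finsupp.single i x :=
  LoopAlgebra.toFinsupp_single_tmul ℂ ℤ 𝔤 i x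

theorem loop_induction {P : Loop 𝔤 → Prop} (f : Loop 𝔤)
    (h0 : P 0) (hadd : ∀ f g, P f → P g → P (f + g)) (h : ∀ x i, P (loopElt x i)) : P f := by
  rw [← (Loop.coeffs 𝔤).symm_apply_apply f]
  induction Loop.coeffs 𝔤 f using Finsupp.induction_linear with
  | zero => simpa
  | add f g hf hg => rw [map_add]; exact hadd _ _ hf hg
  | single i x => rw [← coeffs_loopElt, LinearEquiv.symm_apply_apply]; exact h x i

theorem lie_loopElt (x y : 𝔤) (i j : ℤ) : ⁅loopElt x i, loopElt y j⁆ = loopElt ⁅x, y⁆ (i + j) := by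
  refine (ExtendScalars.bracket_tmul ℂ (AddMonoidAlgebra ℂ ℤ) 𝔤 𝔤 _ _ x y).trans ?_
  rw [AddMonoidAlgebra.single_mul_single, mul_one]
  rfl

theorem loopDerivation_loopElt (x : 𝔤) (i : ℤ) :
    loopDerivation 𝔤 (loopElt x i) = (i : ℂ) • loopElt x i := by
  change (eulerDerivation (AddMonoidAlgebra.single i 1) ⊗ₜ x : loopAlgebra ℂ ℤ 𝔤) = _
  rw [eulerDerivation_single, ← TensorProduct.smul_tmul']
  rfl

theorem affineCocycle_loopElt (x y : 𝔤) (i j : ℤ) :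
    affineCocycle 𝔤 (loopElt x i) (loopElt y j) =
      if i = -j then (i : ℂ) * killingForm ℂ 𝔤 x y else 0 := by
  change LoopAlgebra.residuePairing ℂ ℤ 𝔤 (killingForm ℂ 𝔤) (AddMonoidAlgebra.single j 1 ⊗ₜ y)
    (AddMonoidAlgebra.single i 1 ⊗ₜ x) = _
  simp only [LoopAlgebra.residuePairing_apply_apply, LoopAlgebra.toFinsupp_single_tmul]
  rw [Finsupp.sum_single_index (by simp)]
  split_ifs with h
  · subst h
    simp [LieModule.traceForm_comm ℂ 𝔤 𝔤 x y]
  · rw [Finsupp.single_eq_of_ne (by omega)]; simp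

theorem affineCocycle_skew (f g : Loop 𝔤) :
    affineCocycle 𝔤 f g = -affineCocycle 𝔤 g f := by
  induction f using loop_induction with
  | h0 => simp
  | hadd f f' hf hf' => simp only [map_add, LinearMap.add_apply, hf, hf']; ring
  | h x i =>
    induction g using loop_induction with
    | h0 => simp
    | hadd g g' hg hg' => simp only [map_add, LinearMap.add_apply, hg, hg']; ring
    | h y j =>
      rw [affineCocycle_loopElt, affineCocycle_loopElt, LieModule.traceForm_comm ℂ 𝔤 𝔤 x y]
      by_cases h : i = -j
      · subst h; simp
      · rw [if_neg h, if_neg (by omega), neg_zero]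

theorem affineCocycle_self (f : Loop 𝔤) : affineCocycle 𝔤 f f = 0 :=
  self_eq_neg.mp (affineCocycle_skew f f)

theorem affineCocycle_lie (f g h : Loop 𝔤) :
    affineCocycle 𝔤 f ⁅g, h⁆ = affineCocycle 𝔤 ⁅f, g⁆ h + affineCocycle 𝔤 g ⁅f, h⁆ := by
  induction f using loop_induction with
  | h0 => simp
  | hadd f f' hf hf' => simp only [map_add, LinearMap.add_apply, add_lie, hf, hf']; ring
  | h x i =>
    induction g using loop_induction with
    | h0 => simp
    | hadd g g' hg hg' => simp only [map_add, LinearMap.add_apply, add_lie, lie_add, hg, hg']; ring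
    | h y j =>
      induction h using loop_induction with
      | h0 => simp
      | hadd h h' hh hh' => simp only [map_add, lie_add, hh, hh']; ring
      | h z k =>
        simp only [lie_loopElt, affineCocycle_loopElt]
        by_cases e : i + j + k = 0
        · rw [if_pos (by omega), if_pos (by omega), if_pos (by omega)]
          have h1 : killingForm ℂ 𝔤 x ⁅y, z⁆ = killingForm ℂ 𝔤 ⁅x, y⁆ z :=
            (LieModule.traceForm_apply_lie_apply ℂ 𝔤 𝔤 x y z).symm
          have h2 : killingForm ℂ 𝔤 y ⁅x, z⁆ = -killingForm ℂ 𝔤 ⁅x, y⁆ z := by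
            rw [← lie_skew x y, map_neg, LinearMap.neg_apply, neg_neg]
            exact (LieModule.traceForm_apply_lie_apply ℂ 𝔤 𝔤 y x z).symm
          rw [h1, h2]
          push_cast
          ring
        · rw [if_neg (by omega), if_neg (by omega), if_neg (by omega), add_zero]

theorem affineCocycle_loopDerivation (f g : Loop 𝔤) :
    affineCocycle 𝔤 (loopDerivation 𝔤 f) g = -affineCocycle 𝔤 f (loopDerivation 𝔤 g) := by
  induction f using loop_induction with
  | h0 => simp
  | hadd f f' hf hf' => simp only [map_add, LinearMap.add_apply, hf, hf']; ring
  | h x i =>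
    induction g using loop_induction with
    | h0 => simp
    | hadd g g' hg hg' => simp only [map_add, hg, hg']; ring
    | h y j =>
      simp only [loopDerivation_loopElt, map_smul, LinearMap.smul_apply, affineCocycle_loopElt]
      by_cases e : i = -j
      · subst e; simp
      · simp [e]

variable (𝔤)

/-- The untwisted affine Lie algebra `L(𝔤) ⊕ ℂ d ⊕ ℂ c`: the triple `⟨f, a, b⟩` stands for
`f + a d + b c`. -/
@[ext]
structure Affine where
  loop : Loop 𝔤
  dCoeff : ℂ
  cCoeff : ℂ

namespace Affine

def equivProd : Affine 𝔤 ≃ Loop 𝔤 × ℂ × ℂ where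
  toFun x := (x.loop, x.dCoeff, x.cCoeff)
  invFun x := ⟨x.1, x.2.1, x.2.2⟩
  left_inv _ := rfl
  right_inv _ := rfl

instance : AddCommGroup (Affine 𝔤) := (equivProd 𝔤).addCommGroup

instance : Module ℂ (Affine 𝔤) := (equivProd 𝔤).module ℂ

/-- The bracket determined by `[x ⊗ t ^ i, y ⊗ t ^ j] = [x, y] ⊗ t ^ (i + j) + i δ_{i,-j} (x, y) c`,
`[d, x ⊗ t ^ i] = i (x ⊗ t ^ i)` and the centrality of `c`. -/
instance : Bracket (Affine 𝔤) (Affine 𝔤) where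
  bracket x y :=
    ⟨⁅x.loop, y.loop⁆ + x.dCoeff • loopDerivation 𝔤 y.loop - y.dCoeff • loopDerivation 𝔤 x.loop,
      0, affineCocycle 𝔤 x.loop y.loop⟩

variable {𝔤}

@[simp] theorem zero_loop : (0 : Affine 𝔤).loop = 0 := rfl
@[simp] theorem zero_dCoeff : (0 : Affine 𝔤).dCoeff = 0 := rfl
@[simp] theorem zero_cCoeff : (0 : Affine 𝔤).cCoeff = 0 := rfl
@[simp] theorem add_loop (x y : Affine 𝔤) : (x + y).loop = x.loop + y.loop := rfl
@[simp] theorem add_dCoeff (x y : Affine 𝔤) : (x + y).dCoeff = x.dCoeff + y.dCoeff := rfl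
@[simp] theorem add_cCoeff (x y : Affine 𝔤) : (x + y).cCoeff = x.cCoeff + y.cCoeff := rfl
@[simp] theorem smul_loop (r : ℂ) (x : Affine 𝔤) : (r • x).loop = r • x.loop := rfl
@[simp] theorem smul_dCoeff (r : ℂ) (x : Affine 𝔤) : (r • x).dCoeff = r • x.dCoeff := rfl
@[simp] theorem smul_cCoeff (r : ℂ) (x : Affine 𝔤) : (r • x).cCoeff = r • x.cCoeff := rfl
@[simp] theorem lie_loop (x y : Affine 𝔤) : ⁅x, y⁆.loop = ⁅x.loop, y.loop⁆ +
    x.dCoeff • loopDerivation 𝔤 y.loop - y.dCoeff • loopDerivation 𝔤 x.loop := rfl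
@[simp] theorem lie_dCoeff (x y : Affine 𝔤) : ⁅x, y⁆.dCoeff = 0 := rfl
@[simp] theorem lie_cCoeff (x y : Affine 𝔤) :
    ⁅x, y⁆.cCoeff = affineCocycle 𝔤 x.loop y.loop := rfl

instance : LieRing (Affine 𝔤) where
  add_lie x y z := by
    ext
    · simp only [lie_loop, add_loop, add_dCoeff, add_lie, map_add, add_smul, smul_add]; abel
    · simp
    · simp
  lie_add x y z := by
    ext
    · simp only [lie_loop, add_loop, add_dCoeff, lie_add, map_add, add_smul, smul_add]; abel
    · simp
    · simp
  lie_self x := by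
    ext
    · simp
    · simp
    · simp [affineCocycle_self]
  leibniz_lie x y z := by
    ext
    · simp only [lie_loop, add_loop, lie_dCoeff, lie_add, add_lie, lie_sub, sub_lie, map_add,
        map_sub, map_smul, smul_add, smul_sub, zero_smul, lie_smul, smul_lie,
        LieDerivation.apply_lie_eq_add, leibniz_lie x.loop y.loop z.loop]
      rw [← lie_skew (loopDerivation 𝔤 x.loop) y.loop]
      module
    · simp
    · simp only [lie_loop, add_cCoeff, lie_cCoeff, map_add, map_sub, map_smul,
        LinearMap.add_apply, LinearMap.sub_apply, LinearMap.smul_apply,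
        affineCocycle_lie x.loop y.loop z.loop, affineCocycle_loopDerivation, smul_neg]
      rw [affineCocycle_skew y.loop (loopDerivation 𝔤 x.loop), affineCocycle_loopDerivation]
      simp only [smul_eq_mul]
      ring

instance : LieAlgebra ℂ (Affine 𝔤) where
  lie_smul r x y := by
    ext
    · simp only [lie_loop, smul_loop, smul_dCoeff, lie_smul, map_smul, smul_add, smul_sub,
        smul_comm x.dCoeff r, smul_assoc]
    · simp
    · simp

/-- The canonical central element `c`. -/
def central : Affine 𝔤 := ⟨0, 0, 1⟩

end Affine

end Affine

/-! ### Parabolic subalgebras and their nilradicals -/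

section Parabolic

variable {𝔤 : Type u} [LieRing 𝔤] [LieAlgebra ℂ 𝔤] [FiniteDimensional ℂ 𝔤] [IsKilling ℂ 𝔤]
  {H : LieSubalgebra ℂ 𝔤} [H.IsCartanSubalgebra]

/-- A proper parabolic subalgebra of `𝔤` containing the Borel subalgebra `𝔥 ⊕ 𝔫₊` attached to the
base `b` of the root system of `(𝔤, 𝔥)`. -/
structure Parabolic (b : (rootSystem H).Base) where
  alg : LieSubalgebra ℂ 𝔤
  cartan_le : H ≤ alg
  rootSpace_le : ∀ α : H.root, b.IsPos α → ∀ x ∈ rootSpace H α.1, x ∈ alg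
  ne_top : alg ≠ ⊤

/-- A choice of a nonzero element in every root space. -/
structure RootVectors (H : LieSubalgebra ℂ 𝔤) [H.IsCartanSubalgebra] where
  vec : H.root → 𝔤
  mem : ∀ α : H.root, vec α ∈ rootSpace H α.1
  ne_zero : ∀ α : H.root, vec α ≠ 0

variable {b : (rootSystem H).Base} (P : Parabolic b)

namespace Parabolic

/-- The nilradical of `𝔭` as an ideal of `𝔭`: the sum of all ideals of `𝔭` which are nilpotent
Lie algebras. -/
def nilIdeal : LieIdeal ℂ P.alg := sSup {I : LieIdeal ℂ P.alg | LieRing.IsNilpotent I}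

/-- The nilradical `𝔫` of `𝔭`, as a Lie subalgebra of `𝔤`. -/
def nil : LieSubalgebra ℂ 𝔤 := (P.nilIdeal.toLieSubalgebra ℂ P.alg).map P.alg.incl

/-- The derived algebra `[𝔫, 𝔫]`. -/
def nilDerived : Submodule ℂ 𝔤 := Submodule.span ℂ {z | ∃ x ∈ P.nil, ∃ y ∈ P.nil, ⁅x, y⁆ = z}

/-- The set `Φ_𝔫⁰` of all roots that appear in `𝔫` but not in `[𝔫, 𝔫]`. -/
def genRoots : Set H.root :=
  {α | (∀ x ∈ rootSpace H α.1, x ∈ P.nil) ∧ ¬ ∀ x ∈ rootSpace H α.1, x ∈ P.nilDerived}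

instance : Fintype P.genRoots := Fintype.ofFinite _

theorem mem_nil_iff {x : 𝔤} : x ∈ P.nil ↔ ∃ h : x ∈ P.alg, (⟨x, h⟩ : P.alg) ∈ P.nilIdeal := by
  constructor
  · rintro ⟨y, hy, rfl⟩
    exact ⟨y.2, hy⟩
  · rintro ⟨h, hx⟩
    exact ⟨⟨x, h⟩, hx, rfl⟩

/-- An ideal of `𝔭`, as an `𝔥`-submodule of `𝔤`. -/
def idealSubmodule (I : LieIdeal ℂ P.alg) : LieSubmodule ℂ H 𝔤 where
  toSubmodule := I.toSubmodule.map P.alg.toSubmodule.subtype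
  lie_mem := by
    rintro h _ ⟨y, hy, rfl⟩
    exact ⟨⁅(⟨h, P.cartan_le h.2⟩ : P.alg), y⁆, lie_mem_right ℂ P.alg I _ y hy, rfl⟩

theorem mem_idealSubmodule {I : LieIdeal ℂ P.alg} {x : 𝔤} :
    x ∈ P.idealSubmodule I ↔ ∃ h : x ∈ P.alg, (⟨x, h⟩ : P.alg) ∈ I := by
  constructor
  · rintro ⟨y, hy, rfl⟩
    exact ⟨y.2, hy⟩
  · rintro ⟨h, hx⟩
    exact ⟨⟨x, h⟩, hx, rfl⟩

theorem eq_zero_of_lie_eq_smul {I : LieIdeal ℂ P.alg} (hI : LieRing.IsNilpotent I) {h e : 𝔤}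
    (hh : h ∈ P.idealSubmodule I) (he : e ∈ P.alg) {c : ℂ} (hc : c ≠ 0) (hhe : ⁅h, e⁆ = c • e) :
    e = 0 := by
  obtain ⟨hp, hhI⟩ := P.mem_idealSubmodule.mp hh
  have heI : (⟨e, he⟩ : P.alg) ∈ I := by
    have h1 : ⁅(⟨h, hp⟩ : P.alg), (⟨e, he⟩ : P.alg)⁆ = c • (⟨e, he⟩ : P.alg) := Subtype.ext hhe
    have h2 : c⁻¹ • ⁅(⟨h, hp⟩ : P.alg), (⟨e, he⟩ : P.alg)⁆ ∈ I :=
      I.smul_mem _ (lie_mem_left ℂ P.alg I _ _ hhI)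
    rwa [h1, inv_smul_smul₀ hc] at h2
  obtain ⟨k, hk⟩ := LieModule.isNilpotent_toEnd_of_isNilpotent ℂ I I ⟨⟨h, hp⟩, hhI⟩
  have hpow : ∀ k : ℕ, ((toEnd ℂ I I ⟨⟨h, hp⟩, hhI⟩) ^ k) ⟨⟨e, he⟩, heI⟩ =
      c ^ k • (⟨⟨e, he⟩, heI⟩ : I) := by
    intro k
    induction k with
    | zero => simp
    | succ k ih =>
      rw [pow_succ', Module.End.mul_apply, ih, map_smul, pow_succ, mul_smul]
      congr 1
      exact Subtype.ext (Subtype.ext hhe)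
  have h3 := hpow k
  rw [hk, LinearMap.zero_apply] at h3
  have h4 := (smul_eq_zero.mp h3.symm).resolve_left (pow_ne_zero _ hc)
  exact congrArg (fun z : I => ((z : P.alg) : 𝔤)) h4

theorem eq_zero_of_mem_cartan {I : LieIdeal ℂ P.alg} (hI : LieRing.IsNilpotent I) {h : 𝔤}
    (hh : h ∈ P.idealSubmodule I) (hH : h ∈ H) : h = 0 := by
  have key : ∀ α : Weight ℂ H 𝔤, α ⟨h, hH⟩ = 0 := by
    have pos : ∀ α : H.root, b.IsPos α → α.1 ⟨h, hH⟩ = 0 := by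
      intro α hα
      by_contra hne
      obtain ⟨e, he, he0⟩ := α.1.exists_ne_zero
      exact he0 (P.eq_zero_of_lie_eq_smul hI hh (P.rootSpace_le α hα e he) hne
        (lie_eq_smul_of_mem_rootSpace he ⟨h, hH⟩))
    intro α
    by_cases hα : α.IsZero
    · rw [hα.eq]; rfl
    · let α' : H.root := ⟨α, by simpa using hα⟩
      let := (rootSystem H).indexNeg
      rcases RootPairing.Base.IsPos.or_neg b α' with h1 | h1
      · exact pos α' h1
      · have h2 := pos _ h1
        have h3 : ((-α' : H.root) : Weight ℂ H 𝔤).toLinear = -α.toLinear :=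
          (rootSystem H).root_reflectionPerm α' α' |>.trans (by
            rw [RootPairing.reflection_apply_self]; rfl)
        have h4 := LinearMap.congr_fun h3 ⟨h, hH⟩
        rw [LinearMap.neg_apply, Weight.toLinear_apply, Weight.toLinear_apply, h2] at h4
        exact neg_eq_zero.mp h4.symm
  have h1 : (⟨h, hH⟩ : H) ∈ (⨅ α : Weight ℂ H 𝔤, α.ker : Submodule ℂ H) := by
    rw [Submodule.mem_iInf]
    exact fun α => key α
  rw [iInf_ker_weight_eq_bot, Submodule.mem_bot] at h1
  exact congrArg Subtype.val h1

theorem killingForm_ideal {I J : LieIdeal ℂ P.alg} (hI : LieRing.IsNilpotent I)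
    {x y : 𝔤} (hx : x ∈ P.idealSubmodule I) (hy : y ∈ P.idealSubmodule J) :
    killingForm ℂ 𝔤 x y = 0 := by
  replace hx := (LieModule.eq_iSup_inf_genWeightSpace ℂ H 𝔤 (P.idealSubmodule I)).le hx
  induction hx using LieSubmodule.iSup_induction' with
  | zero => simp
  | add x x' _ _ h h' => rw [map_add, LinearMap.add_apply, h, h', add_zero]
  | mem χ x hx =>
    replace hy := (LieModule.eq_iSup_inf_genWeightSpace ℂ H 𝔤 (P.idealSubmodule J)).le hy
    induction hy using LieSubmodule.iSup_induction' with
    | zero => simp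
    | add y y' _ _ h h' => rw [map_add, h, h', add_zero]
    | mem ψ y hy =>
      obtain ⟨hxI, hxχ⟩ := hx
      obtain ⟨hyJ, hyψ⟩ := hy
      by_cases hsum : (χ : H → ℂ) + ψ = 0
      · have hψ : (ψ : H → ℂ) = -χ := (neg_eq_of_add_eq_zero_right hsum).symm
        by_cases hχ : χ.IsZero
        · have : x ∈ H := by
            rw [hχ.eq] at hxχ
            have h1 : x ∈ rootSpace H (0 : H → ℂ) := hxχ
            rwa [rootSpace_zero_eq, LieSubalgebra.mem_toLieSubmodule] at h1
          rw [P.eq_zero_of_mem_cartan hI hxI this]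
          simp
        · have hlie := lie_eq_killingForm_smul_of_mem_rootSpace_of_mem_rootSpace_neg (α := χ)
            hxχ (by rw [← hψ]; exact hyψ)
          have hmem : ⁅x, y⁆ ∈ P.idealSubmodule I := by
            obtain ⟨hxp, hxI⟩ := P.mem_idealSubmodule.mp hxI
            obtain ⟨hyp, -⟩ := P.mem_idealSubmodule.mp hyJ
            exact P.mem_idealSubmodule.mpr ⟨P.alg.lie_mem hxp hyp,
              lie_mem_left ℂ P.alg I ⟨x, hxp⟩ ⟨y, hyp⟩ hxI⟩
          have h0 := P.eq_zero_of_mem_cartan hI hmem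
            (by rw [hlie]; exact H.smul_mem _ (Submodule.coe_mem _))
          rw [hlie, smul_eq_zero] at h0
          refine h0.resolve_right fun h1 => ?_
          have h2 := root_apply_cartanEquivDual_symm_ne_zero hχ
          have h3 : (cartanEquivDual H).symm χ.toLinear = 0 := Subtype.ext h1
          exact h2 (by rw [h3, ← Weight.toLinear_apply, map_zero])
      · exact killingForm_apply_eq_zero_of_mem_rootSpace_of_add_ne_zero ℂ 𝔤 H hxχ hyψ hsum

theorem killingForm_nil {x y : 𝔤} (hx : x ∈ P.nil) (hy : y ∈ P.nil) :
    killingForm ℂ 𝔤 x y = 0 := by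
  obtain ⟨hxp, hx⟩ := P.mem_nil_iff.mp hx
  obtain ⟨hyp, hy⟩ := P.mem_nil_iff.mp hy
  suffices ∀ x ∈ P.nilIdeal, ∀ y ∈ P.nilIdeal, killingForm ℂ 𝔤 x y = 0 from
    this _ hx _ hy
  intro x hx y hy
  rw [nilIdeal, sSup_eq_iSup'] at hx
  induction hx using LieSubmodule.iSup_induction' with
  | zero => simp
  | add x x' _ _ h h' =>
    rw [AddMemClass.coe_add, map_add, LinearMap.add_apply, h, h', add_zero]
  | mem I x hx =>
    exact P.killingForm_ideal I.2 (P.mem_idealSubmodule.mpr ⟨x.2, hx⟩)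
      (P.mem_idealSubmodule.mpr ⟨y.2, hy⟩)

theorem lie_cartan_mem_nil {h x : 𝔤} (hh : h ∈ H) (hx : x ∈ P.nil) : ⁅h, x⁆ ∈ P.nil := by
  obtain ⟨hxp, hx⟩ := P.mem_nil_iff.mp hx
  exact P.mem_nil_iff.mpr ⟨P.alg.lie_mem (P.cartan_le hh) hxp,
    lie_mem_right ℂ P.alg P.nilIdeal ⟨h, P.cartan_le hh⟩ ⟨x, hxp⟩ hx⟩

/-- The derived algebra `[𝔫, 𝔫]` as an `𝔥`-submodule of `𝔤`. -/
def nilDerivedSubmodule : LieSubmodule ℂ H 𝔤 where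
  toSubmodule := P.nilDerived
  lie_mem := by
    intro h z hz
    change z ∈ P.nilDerived at hz
    change ⁅h, z⁆ ∈ P.nilDerived
    induction hz using Submodule.span_induction with
    | zero => rw [lie_zero]; exact zero_mem _
    | add x y _ _ hx hy => rw [lie_add]; exact add_mem hx hy
    | smul c x _ hx => rw [lie_smul]; exact Submodule.smul_mem _ _ hx
    | mem z hz =>
      obtain ⟨x, hx, y, hy, rfl⟩ := hz
      rw [leibniz_lie]
      exact add_mem (Submodule.subset_span ⟨_, P.lie_cartan_mem_nil h.2 hx, y, hy, rfl⟩)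
        (Submodule.subset_span ⟨x, hx, _, P.lie_cartan_mem_nil h.2 hy, rfl⟩)

end Parabolic

namespace RootVectors

variable (X : RootVectors H)

theorem exists_coeff (α : H.root) : ∃ f : Module.Dual ℂ 𝔤, f (X.vec α) = 1 ∧
    ∀ χ : H → ℂ, χ ≠ α.1 → ∀ x ∈ rootSpace H χ, f x = 0 := by
  obtain ⟨y, hy, hne⟩ : ∃ y ∈ rootSpace H (-α.1 : H → ℂ), killingForm ℂ 𝔤 (X.vec α) y ≠ 0 := by
    by_contra! hcon
    refine X.ne_zero α ?_
    simpa using mem_ker_killingForm_of_mem_rootSpace_of_forall_rootSpace_neg ℂ 𝔤 H (X.mem α) hcon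
  refine ⟨(killingForm ℂ 𝔤 (X.vec α) y)⁻¹ • (killingForm ℂ 𝔤).flip y, ?_, ?_⟩
  · simp [hne]
  · intro χ hχ x hx
    have : killingForm ℂ 𝔤 x y = 0 :=
      killingForm_apply_eq_zero_of_mem_rootSpace_of_add_ne_zero ℂ 𝔤 H hx hy
        (fun h => hχ (by rwa [← sub_eq_add_neg, sub_eq_zero] at h))
    simp [this]

/-- The linear functional on `𝔤` which reads off the coefficient of `X_α` in the root space
decomposition: it equals `1` at `X_α` and vanishes on `𝔥` and on all other root spaces. -/
def coeff (α : H.root) : Module.Dual ℂ 𝔤 := (X.exists_coeff α).choose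

theorem coeff_self (α : H.root) : X.coeff α (X.vec α) = 1 := (X.exists_coeff α).choose_spec.1

theorem coeff_of_ne {α : H.root} {χ : H → ℂ} (hχ : χ ≠ α.1) {x : 𝔤} (hx : x ∈ rootSpace H χ) :
    X.coeff α x = 0 := (X.exists_coeff α).choose_spec.2 χ hχ x hx

theorem coeff_nilDerived {α : H.root} (hα : α ∈ P.genRoots) {z : 𝔤} (hz : z ∈ P.nilDerived) :
    X.coeff α z = 0 := by
  have hz' : z ∈ P.nilDerivedSubmodule := hz
  replace hz' := (LieModule.eq_iSup_inf_genWeightSpace ℂ H 𝔤 P.nilDerivedSubmodule).le hz'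
  clear hz
  induction hz' using LieSubmodule.iSup_induction' with
  | zero => simp
  | add x y _ _ hx hy => rw [map_add, hx, hy, add_zero]
  | mem χ x hx =>
    obtain ⟨hxD, hxχ⟩ := hx
    by_cases hχ : χ = α.1
    · rw [hχ] at hxχ
      by_contra hne
      refine hα.2 fun y hy => ?_
      have hx0 : (⟨x, hxχ⟩ : rootSpace H α.1) ≠ 0 := fun h => hne (by
        have : x = 0 := congrArg Subtype.val h
        rw [this, map_zero])
      obtain ⟨c, hc⟩ := (finrank_eq_one_iff_of_nonzero' _ hx0).mp
        (finrank_rootSpace_eq_one α.1 (H.isNonZero_coe_root α)) ⟨y, hy⟩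
      have hc' : c • x = y := congrArg Subtype.val hc
      rw [← hc']
      exact Submodule.smul_mem _ _ hxD
    · exact X.coeff_of_ne (fun h => hχ (DFunLike.coe_injective h)) hxχ

end RootVectors

/-! ### The subalgebra `L(𝔫)` of the affine Lie algebra and its characters -/

namespace Parabolic

/-- The inclusion `L(𝔫) → L(𝔤)`. -/
def loopNilMap : Loop P.nil →ₗ⁅ℂ⁆ Loop 𝔤 :=
  (ExtendScalars.map (AlgHom.id ℂ (AddMonoidAlgebra ℂ ℤ)) P.nil.incl :
    loopAlgebra ℂ ℤ P.nil →ₗ⁅ℂ⁆ loopAlgebra ℂ ℤ 𝔤)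

theorem loopNilMap_loopElt (x : P.nil) (i : ℤ) :
    P.loopNilMap (loopElt x i) = loopElt (x : 𝔤) i := rfl

theorem affineCocycle_loopNilMap (f g : Loop P.nil) :
    affineCocycle 𝔤 (P.loopNilMap f) (P.loopNilMap g) = 0 := by
  induction f using loop_induction with
  | h0 => simp
  | hadd f f' hf hf' => simp only [map_add, LinearMap.add_apply, hf, hf', add_zero]
  | h x i =>
    induction g using loop_induction with
    | h0 => simp
    | hadd g g' hg hg' => simp only [map_add, hg, hg', add_zero]
    | h y j =>
      rw [loopNilMap_loopElt, loopNilMap_loopElt, affineCocycle_loopElt,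
        P.killingForm_nil x.2 y.2, mul_zero, ite_self]

/-- The inclusion of `L(𝔫)` into the affine Lie algebra. -/
def loopNilIncl : Loop P.nil →ₗ⁅ℂ⁆ Affine 𝔤 where
  toFun f := ⟨P.loopNilMap f, 0, 0⟩
  map_add' f g := by ext <;> simp
  map_smul' r f := by ext <;> simp
  map_lie' {f g} := by
    ext
    · simp
    · simp
    · simp [affineCocycle_loopNilMap]

/-- The linear functional on `L(𝔫)` given by `X_α ⊗ t ^ j ↦ Λ(α)_j` for `α ∈ Φ_𝔫⁰` and by
`x ⊗ t ^ j ↦ 0` for `x` in the other root spaces in `𝔫`. -/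
def whittakerFunctional (X : RootVectors H) (Λ : P.genRoots → ℤ → ℂ) :
    Loop P.nil →ₗ[ℂ] ℂ :=
  (Finsupp.lsum ℂ fun j : ℤ => ∑ α : P.genRoots, Λ α j • (X.coeff α ∘ₗ P.nil.toSubmodule.subtype))
    ∘ₗ (Loop.coeffs P.nil).toLinearMap

theorem whittakerFunctional_loopElt (X : RootVectors H) (Λ : P.genRoots → ℤ → ℂ)
    (x : P.nil) (j : ℤ) :
    P.whittakerFunctional X Λ (loopElt x j) = ∑ α : P.genRoots, Λ α j * X.coeff α x := by
  simp only [whittakerFunctional, LinearMap.comp_apply, LinearEquiv.coe_coe]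
  rw [coeffs_loopElt, Finsupp.lsum_single]
  simp

theorem whittakerFunctional_lie (X : RootVectors H) (Λ : P.genRoots → ℤ → ℂ)
    (f g : Loop P.nil) : P.whittakerFunctional X Λ ⁅f, g⁆ = 0 := by
  induction f using loop_induction with
  | h0 => simp
  | hadd f f' hf hf' => rw [add_lie, map_add, hf, hf', add_zero]
  | h x i =>
    induction g using loop_induction with
    | h0 => simp
    | hadd g g' hg hg' => rw [lie_add, map_add, hg, hg', add_zero]
    | h y j =>
      rw [lie_loopElt, whittakerFunctional_loopElt]
      refine Finset.sum_eq_zero fun α _ => ?_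
      rw [LieSubalgebra.coe_bracket,
        X.coeff_nilDerived P α.2 (Submodule.subset_span ⟨x, x.2, y, y.2, rfl⟩), mul_zero]

attribute [local instance 100] LieRing.ofAssociativeRing in
/-- The character of `L(𝔫)` attached to `Λ`: it sends `X_α ⊗ t ^ j` to `Λ(α)_j`, for
`α ∈ Φ_𝔫⁰`, and vanishes on `[L(𝔫), L(𝔫)]`. -/
def whittakerCharacter (X : RootVectors H) (Λ : P.genRoots → ℤ → ℂ) :
    LieCharacter ℂ (Loop P.nil) where
  toLinearMap := P.whittakerFunctional X Λ
  map_lie' {f g} := by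
    change P.whittakerFunctional X Λ ⁅f, g⁆ = _
    rw [whittakerFunctional_lie, LieRing.of_associative_ring_bracket, mul_comm, sub_self]

theorem whittakerCharacter_rootVector (X : RootVectors H) (Λ : P.genRoots → ℤ → ℂ)
    (α : P.genRoots) (j : ℤ) :
    P.whittakerCharacter X Λ (loopElt ⟨X.vec α, α.2.1 _ (X.mem α)⟩ j) = Λ α j := by
  change P.whittakerFunctional X Λ _ = _
  rw [whittakerFunctional_loopElt, Finset.sum_eq_single_of_mem α (Finset.mem_univ _)]
  · simp [X.coeff_self]
  · intro β _ hβ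
    rw [X.coeff_of_ne (χ := α.1.1) _ (X.mem α), mul_zero]
    intro h
    exact hβ (Subtype.ext (Subtype.ext (DFunLike.coe_injective h.symm)))

end Parabolic

end Parabolic

/-! ### Induced modules -/

section Induction

/-- The one-dimensional `U(L)`-module `ℂ` on which `L` acts through the character `χ`. -/
def CharModule {L : Type u} [LieRing L] [LieAlgebra ℂ L] (_ : LieCharacter ℂ L) : Type := ℂ

variable {L : Type u} [LieRing L] [LieAlgebra ℂ L] (χ : LieCharacter ℂ L)

instance : AddCommGroup (CharModule χ) := inferInstanceAs (AddCommGroup ℂ)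

instance : Module ℂ (CharModule χ) := inferInstanceAs (Module ℂ ℂ)

instance : Module (UniversalEnvelopingAlgebra ℂ L) (CharModule χ) :=
  Module.compHom ℂ (UniversalEnvelopingAlgebra.lift ℂ χ).toRingHom

/-- The tensor product `B ⊗_A N` for a homomorphism `f : A → B` of (noncommutative) `ℂ`-algebras
and a left `A`-module `N`: the quotient of `B ⊗_ℂ N` by all relations `b f(a) ⊗ n = b ⊗ a n`. -/
def BaseExtension {A B : Type*} [Ring A] [Algebra ℂ A] [Ring B] [Algebra ℂ B] (f : A →ₐ[ℂ] B)
    (N : Type*) [AddCommGroup N] [Module ℂ N] [Module A N] : Type _ :=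
  (B ⊗[ℂ] N) ⧸ Submodule.span B {z | ∃ (b : B) (a : A) (n : N),
    z = (b * f a) ⊗ₜ[ℂ] n - b ⊗ₜ[ℂ] (a • n)}

variable {A B : Type*} [Ring A] [Algebra ℂ A] [Ring B] [Algebra ℂ B] (f : A →ₐ[ℂ] B)
    (N : Type*) [AddCommGroup N] [Module ℂ N] [Module A N]

instance : AddCommGroup (BaseExtension f N) :=
  inferInstanceAs (AddCommGroup ((B ⊗[ℂ] N) ⧸ Submodule.span B _))

instance : Module B (BaseExtension f N) :=
  inferInstanceAs (Module B ((B ⊗[ℂ] N) ⧸ Submodule.span B _))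

end Induction

section Whittaker

variable (𝔤 : Type u) [LieRing 𝔤] [LieAlgebra ℂ 𝔤]

/-- The quotient `U_θ` of the universal enveloping algebra of the affine Lie algebra by the
two-sided ideal generated by `c - θ`. -/
def LevelAlgebra (θ : ℂ) : Type u :=
  (TwoSidedIdeal.span {UniversalEnvelopingAlgebra.ι ℂ (Affine.central : Affine 𝔤) -
    algebraMap ℂ (UniversalEnvelopingAlgebra ℂ (Affine 𝔤)) θ}).ringCon.Quotient

variable (θ : ℂ)

instance : Ring (LevelAlgebra 𝔤 θ) := inferInstanceAs (Ring (RingCon.Quotient _))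

instance : Algebra ℂ (LevelAlgebra 𝔤 θ) := inferInstanceAs (Algebra ℂ (RingCon.Quotient _))

/-- The projection `U(𝔤^) → U_θ`. -/
def levelProj : UniversalEnvelopingAlgebra ℂ (Affine 𝔤) →ₐ[ℂ] LevelAlgebra 𝔤 θ :=
  RingCon.mkₐ ℂ _

variable {𝔤} [FiniteDimensional ℂ 𝔤] [IsKilling ℂ 𝔤]
  {H : LieSubalgebra ℂ 𝔤} [H.IsCartanSubalgebra] {b : (rootSystem H).Base}

attribute [local instance 100] LieRing.ofAssociativeRing in
/-- The homomorphism `U(L(𝔫)) → U(𝔤^) → U_θ`. -/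
def nilToLevel (P : Parabolic b) :
    UniversalEnvelopingAlgebra ℂ (Loop P.nil) →ₐ[ℂ] LevelAlgebra 𝔤 θ :=
  (levelProj 𝔤 θ).comp (UniversalEnvelopingAlgebra.lift ℂ
    ((UniversalEnvelopingAlgebra.ι ℂ).comp P.loopNilIncl))

/-- The module `M(Λ, θ) = U_θ ⊗_{U(L(𝔫))} ℂ_Λ`, regarded as a module over `U(𝔤^)`. -/
def inducedWhittaker (P : Parabolic b) (X : RootVectors H) (Λ : P.genRoots → ℤ → ℂ) (θ : ℂ) :
    ModuleCat.{u} (UniversalEnvelopingAlgebra ℂ (Affine 𝔤)) :=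
  (ModuleCat.restrictScalars (levelProj 𝔤 θ).toRingHom).obj
    (ModuleCat.of (LevelAlgebra 𝔤 θ)
      (BaseExtension (nilToLevel θ P) (CharModule (P.whittakerCharacter X Λ))))

end Whittaker

/-- A family `(a_k)` of elements of `ℂ^ℤ` is strongly generic (as a multiset) if the multiset of
all `ℤ`-translates of all `a_k`, together with the set of all elements `(i (a_k)_i)_i`, is linearly
independent. -/
def StronglyGeneric {K : Type*} (a : K → ℤ → ℂ) : Prop :=
  LinearIndependent ℂ (Sum.elim
    (fun p : K × ℤ => fun i : ℤ => a p.1 (i + p.2))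
    (fun v : Set.range (fun k : K => fun i : ℤ => (i : ℂ) * a k i) => (v : ℤ → ℂ)))

end AffineWhittaker

end

/-!
# Self-extensions of the induced modules `M(Λ, θ)`

Write `U = U(𝔤^)`, let `v` be the generator of `M = M(Λ, θ)` and `I = Ann_U(v)`, the left ideal
generated by `c - θ` and by the elements `x - Λ(x)` for `x ∈ L(𝔫)`. The exact sequence
`0 → I → U → M → 0` yields the exact sequence
`M = Hom_U(U, M) → Hom_U(I, M) → Ext¹_U(M, M)`.
The algebra `U`, and with it `M`, has countable dimension, so it suffices that `Hom_U(I, M)` has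
uncountable dimension (`aleph0_lt_rank_ext`). For this fix a root `α ∈ Φ_𝔫⁰`. Every sequence
`μ : ℤ → ℂ` is realized by a homomorphism `I → M` with `X_α ⊗ t ^ j - Λ(α)_j ↦ μ_j v`
(`exists_annIdeal_hom`); as `v ≠ 0` (`genVec_ne_zero`), this makes `ℂ^ℤ` a quotient of
`Hom_U(I, M)`.

Both facts about `M` are instances of a relative Poincaré-Birkhoff-Witt theorem. Let `A` be a
subalgebra of a Lie algebra `G`, let `Y` index a basis of a complement of `A`, let `χ` and `μ` be
characters of `A`, let `N` be a `G`-module, and let `v ∈ N` satisfy `a v = χ(a) v` for `a ∈ A`. Then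
`k[Y] ⊕ N` carries a `G`-module structure (`ExtensionDatum.rep`) that extends the one on `N` and
satisfies `a · 1 = χ(a) 1 + μ(a) v` for `a ∈ A`. The case `N = 0` gives `v ≠ 0` in `M`. In the case
`N = M` the quotient by `N` kills `I · 1`, so `u ↦ u · 1` maps `I` to `N = M`, and this is the
required homomorphism.

That `Φ_𝔫⁰` is nonempty (`Parabolic.genRoots_nonempty`) is seen from heights. The orthogonal of `𝔭`
for the Killing form is nonzero and contained in `𝔫₊`; hence it is a nilpotent ideal of `𝔭`, and
`𝔫 ≠ 0`. Moreover `𝔫 ⊆ 𝔫₊`, and a root of minimal height in `𝔫` cannot occur in `[𝔫, 𝔫]`.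
-/

noncomputable section

namespace AffineWhittaker

/-! ### A relative Poincaré-Birkhoff-Witt theorem -/

/-- Data for extending the module induced from a character of a subalgebra by a `G`-module `N`.
The vectors `e y` are independent modulo the subalgebra `A = ker coord` and span a complement of it;
the restrictions to `A` of the linear forms `χ` and `μ` are characters, and `v ∈ N` is a vector of
weight `χ` for `A`. -/
structure ExtensionDatum (k G N Y : Type*) [CommRing k] [LieRing G] [LieAlgebra k G]
    [AddCommGroup N] [Module k N] where
  e : Y → G
  coord : G →ₗ[k] Y →₀ k
  coord_e : ∀ y, coord (e y) = Finsupp.single y 1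
  coord_lie : ∀ a b, coord a = 0 → coord b = 0 → coord ⁅a, b⁆ = 0
  ρ : G →ₗ[k] N →ₗ[k] N
  ρ_lie : ∀ g h w, ρ ⁅g, h⁆ w = ρ g (ρ h w) - ρ h (ρ g w)
  χ : G →ₗ[k] k
  μ : G →ₗ[k] k
  χ_lie : ∀ a b, coord a = 0 → coord b = 0 → χ ⁅a, b⁆ = 0
  μ_lie : ∀ a b, coord a = 0 → coord b = 0 → μ ⁅a, b⁆ = 0
  v : N
  ρ_v : ∀ a, coord a = 0 → ρ a v = χ a • v

namespace ExtensionDatum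

variable {k G N Y : Type*} [CommRing k] [LieRing G] [LieAlgebra k G]
    [AddCommGroup N] [Module k N]

variable (k N Y) in
/-- The underlying space `k[Y] ⊕ N` of the extension. A multiset `m` stands for the product of the
elements `e y`, `y ∈ m`, in increasing order, applied to the generating vector. -/
def Space : Type _ := (Multiset Y →₀ k) × N

instance : AddCommGroup (Space k N Y) := inferInstanceAs (AddCommGroup ((Multiset Y →₀ k) × N))

instance : Module k (Space k N Y) := inferInstanceAs (Module k ((Multiset Y →₀ k) × N))

/-- The basis vector of `k[Y] ⊕ N` attached to the multiset `m`. -/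
def mon (m : Multiset Y) : Space k N Y := ((Finsupp.single m 1, 0) : (Multiset Y →₀ k) × N)

variable (k Y) in
/-- The inclusion of `N` into `k[Y] ⊕ N`. -/
def incl : N →ₗ[k] Space k N Y := LinearMap.inr k (Multiset Y →₀ k) N

theorem incl_injective :
    Function.Injective (incl k Y : N →ₗ[k] Space k N Y) :=
  LinearMap.inr_injective (R := k) (M := Multiset Y →₀ k) (M₂ := N)

theorem mon_notMem_range_incl [Nontrivial k] (m : Multiset Y) :
    (mon m : Space k N Y) ∉ LinearMap.range (incl k Y : N →ₗ[k] Space k N Y) := by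
  rintro ⟨w, hw⟩
  have h1 : (0 : Multiset Y →₀ k) = Finsupp.single m 1 :=
    congrArg (Prod.fst : (Multiset Y →₀ k) × N → _) hw
  exact one_ne_zero (Finsupp.single_eq_zero.mp h1.symm)

/-- The linear map on `Space k N Y` with prescribed values on monomials and on `N`. -/
def spaceLift {W : Type*} [AddCommGroup W] [Module k W] (f : Multiset Y → W) (g : N →ₗ[k] W) :
    Space k N Y →ₗ[k] W :=
  LinearMap.coprod (Finsupp.linearCombination k f) g

theorem spaceLift_mon {W : Type*} [AddCommGroup W] [Module k W] (f : Multiset Y → W)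
    (g : N →ₗ[k] W) (m : Multiset Y) : spaceLift f g (mon m : Space k N Y) = f m := by
  change LinearMap.coprod (Finsupp.linearCombination k f) g (Finsupp.single m 1, 0) = _
  simp

theorem spaceLift_incl {W : Type*} [AddCommGroup W] [Module k W] (f : Multiset Y → W)
    (g : N →ₗ[k] W) (w : N) : spaceLift f g (incl k Y w) = g w := by
  change LinearMap.coprod (Finsupp.linearCombination k f) g (0, w) = _
  simp

variable (k N) in
/-- The filtration by degree of `k[Y] ⊕ N`, with `N` placed in degree `0`. -/
def filt (n : ℕ) : Submodule k (Space k N Y) :=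
  Submodule.span k ({x | ∃ m : Multiset Y, m.card ≤ n ∧ x = mon m} ∪ {x | ∃ w : N, x = incl k Y w})

theorem mon_mem_filt {m : Multiset Y} {n : ℕ} (h : m.card ≤ n) :
    (mon m : Space k N Y) ∈ filt k N n := Submodule.subset_span (Or.inl ⟨m, h, rfl⟩)

theorem incl_mem_filt (w : N) (n : ℕ) : incl k Y w ∈ filt k N n :=
  Submodule.subset_span (Or.inr ⟨w, rfl⟩)

theorem filt_mono {n n' : ℕ} (h : n ≤ n') : filt (Y := Y) k N n ≤ filt k N n' := by
  apply Submodule.span_mono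
  rintro x (⟨m, hm, rfl⟩ | ⟨w, rfl⟩)
  · exact Or.inl ⟨m, hm.trans h, rfl⟩
  · exact Or.inr ⟨w, rfl⟩

theorem eq_on_filt {W : Type*} [AddCommGroup W] [Module k W] {n : ℕ}
    {f g : Space k N Y →ₗ[k] W} (h : ∀ m : Multiset Y, m.card ≤ n → f (mon m) = g (mon m))
    (h' : ∀ w : N, f (incl k Y w) = g (incl k Y w)) {x} (hx : x ∈ filt k N n) : f x = g x := by
  refine LinearMap.eqOn_span (s := {x | ∃ m : Multiset Y, m.card ≤ n ∧ x = mon m} ∪ _) ?_ hx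
  rintro x (⟨m, hm, rfl⟩ | ⟨w, rfl⟩)
  · exact h m hm
  · exact h' w

theorem map_mem_filt {n n' : ℕ}
    {f : Space k N Y →ₗ[k] Space k N Y}
    (h : ∀ m : Multiset Y, m.card ≤ n → f (mon m) ∈ filt k N n')
    (h' : ∀ w : N, f (incl k Y w) ∈ filt k N n') {x} (hx : x ∈ filt k N n) : f x ∈ filt k N n' := by
  suffices filt k N n ≤ (filt k N n').comap f from this hx
  refine Submodule.span_le.mpr ?_
  rintro x (⟨m, hm, rfl⟩ | ⟨w, rfl⟩)
  · exact h m hm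
  · exact h' w

theorem ext_mon {W : Type*} [AddCommGroup W] [Module k W]
    {f g : Space k N Y →ₗ[k] W} (h : ∀ m : Multiset Y, f (mon m) = g (mon m))
    (h' : ∀ w : N, f (incl k Y w) = g (incl k Y w)) : f = g := by
  refine LinearMap.prod_ext (R := k) (M := Multiset Y →₀ k) (M₂ := N)
    (Finsupp.lhom_ext' fun m => LinearMap.ext_ring ?_) (LinearMap.ext ?_)
  · exact h m
  · exact h'

variable (D : ExtensionDatum k G N Y)

/-- The leading term of the action of `g` on `mon m`, namely `∑ g_y (y m)` if `coord g = (g_y)`. -/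
def top (m : Multiset Y) : G →ₗ[k] Space k N Y :=
  Finsupp.linearCombination k (fun y => mon (y ::ₘ m)) ∘ₗ D.coord

theorem top_mem_filt (m : Multiset Y) (g : G) : D.top m g ∈ filt k N (m.card + 1) := by
  rw [top, LinearMap.comp_apply, Finsupp.linearCombination_apply]
  exact Submodule.sum_mem _ fun y _ => Submodule.smul_mem _ _ (mon_mem_filt (by simp))

variable [LinearOrder Y]

theorem exists_min_cons {m : Multiset Y} (hm : m ≠ 0) :
    ∃ z m', m = z ::ₘ m' ∧ ∀ w ∈ m', z ≤ w := by
  obtain ⟨z, hz, hmin⟩ := m.toFinset.exists_min_image id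
    (by rwa [Finset.nonempty_iff_ne_empty, Ne, Multiset.toFinset_eq_empty])
  rw [Multiset.mem_toFinset] at hz
  exact ⟨z, m.erase z, (Multiset.cons_erase hz).symm,
    fun w hw => hmin w (Multiset.mem_toFinset.mpr (Multiset.mem_of_mem_erase hw))⟩

theorem min_cons_unique {z z' : Y} {m m' : Multiset Y} (h : z ::ₘ m = z' ::ₘ m')
    (hz : ∀ w ∈ m, z ≤ w) (hz' : ∀ w ∈ m', z' ≤ w) : z = z' ∧ m = m' := by
  have h1 : z = z' := by
    apply le_antisymm
    · have : z' ∈ z ::ₘ m := h ▸ Multiset.mem_cons_self _ _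
      rcases Multiset.mem_cons.mp this with h | h
      · exact h.ge
      · exact hz _ h
    · have : z ∈ z' ::ₘ m' := h ▸ Multiset.mem_cons_self _ _
      rcases Multiset.mem_cons.mp this with h | h
      · exact h.ge
      · exact hz' _ h
  subst h1
  exact ⟨rfl, (Multiset.cons_inj_right _).mp h⟩

/-- The part of `top m g` that comes from the `y` with `y ≤ m`. -/
def low (m : Multiset Y) : G →ₗ[k] Space k N Y :=
  Finsupp.linearCombination k (fun y => open Classical in
    if ∀ w ∈ m, y ≤ w then mon (y ::ₘ m) else 0) ∘ₗ D.coord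

/-- The component of `g` in the span of `A` and of the `e y` for which `y ≤ m` fails. -/
def up (m : Multiset Y) : G →ₗ[k] G :=
  LinearMap.id - Finsupp.linearCombination k
    (fun y => open Classical in if ∀ w ∈ m, y ≤ w then D.e y else 0) ∘ₗ D.coord

/-- The element `g` lies in the span of `A` and of the `e y` for which `y ≤ m` fails. -/
def IsUpper (m : Multiset Y) (g : G) : Prop := ∀ y, (∀ w ∈ m, y ≤ w) → D.coord g y = 0

theorem IsUpper.low_eq {m : Multiset Y} {g : G} (h : D.IsUpper m g) : D.low m g = 0 := by
  simp only [low, LinearMap.comp_apply, Finsupp.linearCombination_apply]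
  refine Finset.sum_eq_zero fun y _ => ?_
  dsimp only
  split_ifs with hy
  · rw [h y hy, zero_smul]
  · rw [smul_zero]

theorem IsUpper.up_eq {m : Multiset Y} {g : G} (h : D.IsUpper m g) : D.up m g = g := by
  simp only [up, LinearMap.sub_apply, LinearMap.comp_apply, Finsupp.linearCombination_apply]
  rw [Finsupp.sum, Finset.sum_eq_zero fun y _ => ?_, sub_zero]
  · rfl
  · split_ifs with hy
    · rw [h y hy, zero_smul]
    · rw [smul_zero]

theorem isUpper_of_coord_eq_zero (m : Multiset Y) {g : G} (h : D.coord g = 0) : D.IsUpper m g :=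
  fun y _ => by rw [h]; rfl

theorem IsUpper.coord_eq_zero {g : G} (h : D.IsUpper 0 g) : D.coord g = 0 :=
  Finsupp.ext fun y => h y (by simp)

theorem isUpper_cons {z : Y} {m m' : Multiset Y} {g : G} (h : D.IsUpper (z ::ₘ m) g)
    (hz : ∀ w ∈ m, z ≤ w) : D.IsUpper (z ::ₘ m') g := fun y hy => h y (by
  intro w hw
  have hyz := hy z (Multiset.mem_cons_self _ _)
  rcases Multiset.mem_cons.mp hw with rfl | hw
  · exact hyz
  · exact hyz.trans (hz w hw))

theorem isUpper_e {y z : Y} (h : z < y) (m : Multiset Y) : D.IsUpper (z ::ₘ m) (D.e y) := by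
  intro w hw
  rw [D.coord_e, Finsupp.single_eq_of_ne]
  rintro rfl
  exact (h.trans_le (hw z (Multiset.mem_cons_self _ _))).false

theorem low_e {m : Multiset Y} {y : Y} (h : ∀ w ∈ m, y ≤ w) : D.low m (D.e y) = mon (y ::ₘ m) := by
  simp [low, D.coord_e, if_pos h]

theorem up_e {m : Multiset Y} {y : Y} (h : ∀ w ∈ m, y ≤ w) : D.up m (D.e y) = 0 := by
  simp [up, D.coord_e, if_pos h]

theorem isUpper_up (m : Multiset Y) (g : G) : D.IsUpper m (D.up m g) := by
  classical
  intro y hy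
  simp only [up, LinearMap.sub_apply, LinearMap.comp_apply, LinearMap.id_apply, map_sub,
    Finsupp.linearCombination_apply, Finsupp.sub_apply, Finsupp.sum, map_sum, map_smul,
    Finsupp.finsetSum_apply, Finsupp.smul_apply, apply_ite D.coord, D.coord_e, map_zero]
  rw [sub_eq_zero, Finset.sum_eq_single y]
  · simp [if_pos hy]
  · intro b _ hb
    split_ifs
    · rw [Finsupp.single_eq_of_ne hb.symm, smul_zero]
    · simp
  · intro h
    rw [Finsupp.notMem_support_iff.mp h, zero_smul]

theorem top_eq (m : Multiset Y) (g : G) : D.top m g = D.low m g + D.top m (D.up m g) := by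
  classical
  have : D.top m ∘ₗ D.up m = D.top m - D.low m := by
    rw [up, LinearMap.comp_sub, LinearMap.comp_id]
    congr 1
    rw [low, ← LinearMap.comp_assoc]
    congr 1
    refine Finsupp.lhom_ext' fun y => LinearMap.ext_ring ?_
    simp only [LinearMap.comp_apply, Finsupp.lsingle_apply, Finsupp.linearCombination_single,
      one_smul]
    split_ifs <;> simp [top, D.coord_e]
  have h := LinearMap.congr_fun this g
  rw [LinearMap.comp_apply, LinearMap.sub_apply] at h
  rw [h]; abel

/-- For `z ≤ m` and `u` upper with respect to `z m`, the leading term of `u` on `m` involves only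
monomials `y m` with `z < y`. -/
theorem map_top_eq {W : Type*} [AddCommGroup W] [Module k W] {z : Y} {m : Multiset Y}
    {f g : Space k N Y →ₗ[k] W} (hz : ∀ w ∈ m, z ≤ w)
    (h : ∀ y, z < y → f (mon (y ::ₘ m)) = g (mon (y ::ₘ m))) {u : G}
    (hu : D.IsUpper (z ::ₘ m) u) : f (D.top m u) = g (D.top m u) := by
  simp only [top, LinearMap.comp_apply, Finsupp.linearCombination_apply, Finsupp.sum, map_sum,
    map_smul]
  refine Finset.sum_congr rfl fun y hy => ?_
  rw [h]
  by_contra hn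
  refine Finsupp.mem_support_iff.mp hy (hu y ?_)
  intro w hw
  rcases Multiset.mem_cons.mp hw with rfl | hw
  · exact not_lt.mp hn
  · exact (not_lt.mp hn).trans (hz w hw)

/-- The map that agrees on `A` with the action `a ↦ χ(a) 1 + μ(a) v` on the generating vector. -/
def base : G →ₗ[k] Space k N Y :=
  D.χ.smulRight (mon 0) + D.μ.smulRight (incl k Y D.v)

/-- One step of the recursion for the action on the monomial `m`: for `y ≤ m` put `e y · m = y m`,
and for upper `u` and `m = z m'` with `z` minimal put `u · m = e z · (u · m') + [u, e z] · m'`,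
where the right-hand side is computed with the approximation `prev`. -/
def stepMon (prev : G →ₗ[k] Space k N Y →ₗ[k] Space k N Y) (m : Multiset Y) :
    G →ₗ[k] Space k N Y :=
  D.low m + (open Classical in if hm : m = 0 then D.base else
    let z := (exists_min_cons hm).choose
    prev (D.e z) ∘ₗ prev.flip (mon (m.erase z)) +
      prev.flip (mon (m.erase z)) ∘ₗ (-(LieAlgebra.ad k G (D.e z)))) ∘ₗ D.up m

/-- One step of the recursion for the action on all of `k[Y] ⊕ N`. -/
def step (prev : G →ₗ[k] Space k N Y →ₗ[k] Space k N Y) :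
    G →ₗ[k] Space k N Y →ₗ[k] Space k N Y :=
  (spaceLift (D.stepMon prev) (D.ρ.compr₂ (incl k Y)).flip).flip

/-- The iterates of the recursion. The `p`-th one is the final action in degrees `< p`; earlier
iterates are meaningless in higher degrees. -/
def approx : ℕ → G →ₗ[k] Space k N Y →ₗ[k] Space k N Y
  | 0 => 0
  | p + 1 => D.step (approx p)

theorem step_mon (prev) (g : G) (m : Multiset Y) :
    D.step prev g (mon m) = D.stepMon prev m g := by
  simp [step, spaceLift_mon]

theorem step_inr (prev) (g : G) (w : N) : D.step prev g (incl k Y w) = incl k Y (D.ρ g w) := by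
  simp [step, spaceLift_incl]

theorem step_e (prev) {m : Multiset Y} {y : Y} (h : ∀ w ∈ m, y ≤ w) :
    D.step prev (D.e y) (mon m) = mon (y ::ₘ m) := by
  rw [step_mon, stepMon, LinearMap.add_apply, D.low_e h, LinearMap.comp_apply, D.up_e h, map_zero,
    add_zero]

theorem step_zero (prev) (g : G) : D.step prev g (mon 0) = D.low 0 g + D.base (D.up 0 g) := by
  rw [step_mon, stepMon, dif_pos rfl]; rfl

theorem step_cons (prev) (g : G) {z : Y} {m : Multiset Y} (hz : ∀ w ∈ m, z ≤ w) :
    D.step prev g (mon (z ::ₘ m)) = D.low (z ::ₘ m) g +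
      (prev (D.e z) (prev (D.up (z ::ₘ m) g) (mon m)) +
        prev ⁅D.up (z ::ₘ m) g, D.e z⁆ (mon m)) := by
  have hm : z ::ₘ m ≠ 0 := Multiset.cons_ne_zero
  rw [step_mon, stepMon, dif_neg hm]
  have h1 := (min_cons_unique (exists_min_cons hm).choose_spec.choose_spec.1 hz
    (exists_min_cons hm).choose_spec.choose_spec.2).1
  simp only [← h1, Multiset.erase_cons_head]
  simp only [LinearMap.add_apply, LinearMap.comp_apply, LinearMap.neg_apply, LieAlgebra.ad_apply,
    LinearMap.flip_apply, map_neg]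
  rw [← LinearMap.neg_apply, ← prev.map_neg, lie_skew]

theorem approx_e {p : ℕ} (hp : 1 ≤ p) {m : Multiset Y} {y : Y} (h : ∀ w ∈ m, y ≤ w) :
    D.approx p (D.e y) (mon m) = mon (y ::ₘ m) := by
  obtain ⟨q, rfl⟩ := Nat.exists_eq_add_of_le' hp
  exact D.step_e _ h

theorem approx_inr {p : ℕ} (hp : 1 ≤ p) (g : G) (w : N) :
    D.approx p g (incl k Y w) = incl k Y (D.ρ g w) := by
  obtain ⟨q, rfl⟩ := Nat.exists_eq_add_of_le' hp
  exact D.step_inr _ g w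

/-- In degree `n` the iterates are constant from `n + 1` on, and the action is multiplication up to
terms of degree at most `n`. The two claims need each other: `e z · (u · m')` stays within the reach
of the induction because `u · m'` is `top m' u` up to terms of lower degree. -/
theorem approx_spec (n : ℕ) : ∀ m : Multiset Y, m.card = n → ∀ p, n + 1 ≤ p → ∀ g : G,
    D.approx (p + 1) g (mon m) = D.approx p g (mon m) ∧
      D.approx p g (mon m) - D.top m g ∈ filt k N n := by
  induction n using Nat.strong_induction_on with
  | _ n ih =>
  intro m hm p hp g
  obtain ⟨q, rfl⟩ : ∃ q, p = q + 1 := ⟨p - 1, by omega⟩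
  by_cases hm0 : m = 0
  · subst hm0
    simp only [approx, step_zero, true_and]
    rw [top_eq, base]
    have h1 : D.top 0 (D.up 0 g) = 0 := by
      rw [top, LinearMap.comp_apply, (D.isUpper_up 0 g).coord_eq_zero, map_zero]
    rw [h1, add_zero, add_sub_cancel_left]
    exact add_mem (Submodule.smul_mem _ _ (mon_mem_filt (by simp)))
      (Submodule.smul_mem _ _ (incl_mem_filt _ _))
  · obtain ⟨z, m, rfl, hz⟩ := exists_min_cons hm0
    rw [Multiset.card_cons] at hm
    have hu := D.isUpper_up (z ::ₘ m) g
    set u := D.up (z ::ₘ m) g with hudef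
    have hX := (ih m.card (by omega) m rfl q (by omega) u).2
    -- on the leading term of `u · m`, the element `z` is minimal in every monomial
    have e1 : ∀ r, 1 ≤ r → D.approx r (D.e z) (D.top m u) = D.top (z ::ₘ m) u := by
      intro r hr
      simp only [top, LinearMap.comp_apply, Finsupp.linearCombination_apply, Finsupp.sum, map_sum,
        map_smul]
      refine Finset.sum_congr rfl fun y hy => ?_
      rw [D.approx_e hr, Multiset.cons_swap]
      intro w hw
      rcases Multiset.mem_cons.mp hw with rfl | hw
      · by_contra hn
        refine Finsupp.mem_support_iff.mp hy (hu _ ?_)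
        intro w' hw'
        rcases Multiset.mem_cons.mp hw' with rfl | hw'
        · exact (not_le.mp hn).le
        · exact (not_le.mp hn).le.trans (hz w' hw')
      · exact hz w hw
    have e2 : ∀ r, q ≤ r → ∀ x ∈ filt k N m.card,
        D.approx (r + 1) (D.e z) x = D.approx r (D.e z) x := by
      intro r hr x hx
      refine eq_on_filt (fun m' hm' => ?_) (fun w => ?_) hx
      · exact (ih m'.card (by omega) m' rfl r (by omega) _).1
      · rw [D.approx_inr (by omega), D.approx_inr (by omega)]
    have e3 : ∀ r, q ≤ r → ∀ x ∈ filt k N m.card,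
        D.approx r (D.e z) x ∈ filt k N n := by
      intro r hr x hx
      refine map_mem_filt (fun m' hm' => ?_) (fun w => ?_) hx
      · have h1 := (ih m'.card (by omega) m' rfl r (by omega) (D.e z)).2
        have h2 := D.top_mem_filt m' (D.e z)
        have h3 := add_mem (filt_mono (by omega : m'.card ≤ n) h1)
          (filt_mono (by omega : m'.card + 1 ≤ n) h2)
        rwa [sub_add_cancel] at h3
      · rw [D.approx_inr (by omega)]
        exact incl_mem_filt _ _
    have e4 : ∀ r, q ≤ r → D.approx r (D.e z) (D.approx q u (mon m)) =
        D.top (z ::ₘ m) u + D.approx r (D.e z) (D.approx q u (mon m) - D.top m u) := by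
      intro r hr
      rw [map_sub, e1 r (by omega)]; abel
    constructor
    · change D.step (D.approx (q + 1)) g _ = D.step (D.approx q) g _
      rw [D.step_cons _ _ hz, D.step_cons _ _ hz, ← hudef,
        (ih m.card (by omega) m rfl q (by omega) u).1,
        (ih m.card (by omega) m rfl q (by omega) _).1, e4 _ (by omega), e4 _ le_rfl,
        e2 _ le_rfl _ hX]
    · change D.step (D.approx q) g _ - _ ∈ _
      rw [D.step_cons _ _ hz, ← hudef, top_eq, ← hudef, e4 _ le_rfl]
      have h1 := (ih m.card (by omega) m rfl q (by omega) ⁅u, D.e z⁆).2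
      have h2 := D.top_mem_filt m ⁅u, D.e z⁆
      have h3 := add_mem (filt_mono (by omega : m.card ≤ n) h1)
          (filt_mono (by omega : m.card + 1 ≤ n) h2)
      rw [sub_add_cancel] at h3
      have h4 := add_mem (e3 q le_rfl _ hX) h3
      convert h4 using 1
      abel

theorem approx_stable {m : Multiset Y} {p : ℕ} (hp : m.card + 1 ≤ p) (g : G) :
    D.approx p g (mon m) = D.approx (m.card + 1) g (mon m) := by
  induction p, hp using Nat.le_induction with
  | base => rfl
  | succ p hp ih => rw [(D.approx_spec _ m rfl p hp g).1, ih]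

/-- The action of `G` on `k[Y] ⊕ N`, read off in each degree from a stable iterate. -/
def act : G →ₗ[k] Space k N Y →ₗ[k] Space k N Y :=
  (spaceLift (fun m => (D.approx (m.card + 1)).flip (mon m)) (D.ρ.compr₂ (incl k Y)).flip).flip

theorem act_inr (g : G) (w : N) : D.act g (incl k Y w) = incl k Y (D.ρ g w) := by
  simp [act, spaceLift_incl]

theorem act_mon {m : Multiset Y} {p : ℕ} (hp : m.card + 1 ≤ p) (g : G) :
    D.act g (mon m) = D.approx p g (mon m) := by
  rw [approx_stable D hp]
  simp [act, spaceLift_mon]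

theorem act_e {m : Multiset Y} {y : Y} (h : ∀ w ∈ m, y ≤ w) :
    D.act (D.e y) (mon m) = mon (y ::ₘ m) := by
  rw [D.act_mon le_rfl, D.approx_e (by omega) h]

theorem act_zero {a : G} (ha : D.coord a = 0) :
    D.act a (mon 0) = D.χ a • mon 0 + D.μ a • (incl k Y D.v) := by
  rw [D.act_mon le_rfl]
  change D.step _ a _ = _
  rw [step_zero, (D.isUpper_of_coord_eq_zero 0 ha).low_eq, (D.isUpper_of_coord_eq_zero 0 ha).up_eq,
    zero_add]
  rfl

theorem act_sub_top_mem (g : G) (m : Multiset Y) :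
    D.act g (mon m) - D.top m g ∈ filt k N m.card := by
  rw [D.act_mon le_rfl]
  exact (D.approx_spec _ m rfl _ le_rfl g).2

theorem le_cons {y z : Y} {m : Multiset Y} (h : z < y) (hz : ∀ w ∈ m, z ≤ w) :
    ∀ w ∈ y ::ₘ m, z ≤ w := by
  intro w hw
  rcases Multiset.mem_cons.mp hw with rfl | hw
  · exact h.le
  · exact hz w hw

theorem act_cons {u : G} {z : Y} {m : Multiset Y} (hz : ∀ w ∈ m, z ≤ w)
    (hu : D.IsUpper (z ::ₘ m) u) :
    D.act u (mon (z ::ₘ m)) = D.act (D.e z) (D.act u (mon m)) + D.act ⁅u, D.e z⁆ (mon m) := by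
  have hcard : (z ::ₘ m).card = m.card + 1 := Multiset.card_cons _ _
  rw [D.act_mon (m := z ::ₘ m) (p := m.card + 2) (by omega)]
  change D.step (D.approx (m.card + 1)) u _ = _
  rw [D.step_cons _ _ hz, hu.low_eq, hu.up_eq, zero_add, ← D.act_mon le_rfl, ← D.act_mon le_rfl]
  refine congrArg (· + _) ?_
  have h1 : D.approx (m.card + 1) (D.e z) (D.act u (mon m) - D.top m u) =
      D.act (D.e z) (D.act u (mon m) - D.top m u) := by
    refine eq_on_filt (fun m' hm' => ?_) (fun w => ?_) (D.act_sub_top_mem u m)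
    · rw [D.act_mon (p := m.card + 1) (by omega)]
    · rw [D.approx_inr (by omega), D.act_inr]
  have h2 : D.approx (m.card + 1) (D.e z) (D.top m u) = D.act (D.e z) (D.top m u) := by
    refine D.map_top_eq hz (fun y hy => ?_) hu
    rw [D.approx_e (by omega) (le_cons hy hz), D.act_e (le_cons hy hz)]
  rw [map_sub, map_sub, h2] at h1
  exact sub_left_injective h1

/-- The failure `g · (h · x) - h · (g · x) - [g, h] · x` of the action to be a Lie action at `x`. -/
def defect (x : Space k N Y) : G →ₗ[k] G →ₗ[k] Space k N Y :=
  D.act.compl₂ (D.act.flip x) - (D.act.compl₂ (D.act.flip x)).flip -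
    (LieModule.toEnd k G G : G →ₗ[k] Module.End k G).compr₂ (D.act.flip x)

theorem defect_apply (x : Space k N Y) (g h : G) :
    D.defect x g h = D.act g (D.act h x) - D.act h (D.act g x) - D.act ⁅g, h⁆ x := rfl

theorem defect_swap (x : Space k N Y) (g h : G) :
    D.defect x g h = - D.defect x h g := by
  rw [defect_apply, defect_apply, ← lie_skew g h, map_neg, LinearMap.neg_apply]; abel

theorem span_upper (m : Multiset Y) :
    Submodule.span k ({g | ∃ y, (∀ w ∈ m, y ≤ w) ∧ g = D.e y} ∪ {g | D.IsUpper m g}) = ⊤ := by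
  classical
  refine eq_top_iff.mpr fun g _ => ?_
  have h : g = D.up m g + Finsupp.linearCombination k
      (fun y => if ∀ w ∈ m, y ≤ w then D.e y else 0) (D.coord g) := by
    simp [up]
  rw [h]
  refine add_mem (Submodule.subset_span (Or.inr (D.isUpper_up m g))) ?_
  rw [Finsupp.linearCombination_apply]
  refine Submodule.sum_mem _ fun y _ => Submodule.smul_mem _ _ ?_
  split_ifs with hy
  · exact Submodule.subset_span (Or.inl ⟨y, hy, rfl⟩)
  · exact zero_mem _

/-- Up to the identity `e z · m = z m`, this is the recursion that defines `u · (z m)`. -/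
theorem defect_upper_e {u : G} {z : Y} {m : Multiset Y} (hz : ∀ w ∈ m, z ≤ w)
    (hu : D.IsUpper (z ::ₘ m) u) : D.defect (mon m) u (D.e z) = 0 := by
  rw [defect_apply, D.act_e hz, D.act_cons hz hu]; abel

/-- The elements `e y` with `y ≤ m` are covered by `defect_upper_e`, so only pairs of upper elements
remain. -/
theorem defect_eq_zero_of_upper {m : Multiset Y}
    (h : ∀ u u', D.IsUpper m u → D.IsUpper m u' → D.defect (mon m) u u' = 0) :
    D.defect (mon m) = 0 := by
  have hself : ∀ g, D.defect (mon m) g g = 0 := fun g => by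
    rw [defect_apply, lie_self, map_zero, LinearMap.zero_apply, sub_self, sub_zero]
  have hup : ∀ (u : G) (y : Y), (∀ w ∈ m, y ≤ w) → D.IsUpper m u → D.IsUpper (y ::ₘ m) u :=
    fun u y hy hu w hw => hu w fun w' hw' => hw w' (Multiset.mem_cons_of_mem hw')
  refine LinearMap.ext_on (D.span_upper m) fun g hg => LinearMap.ext_on (D.span_upper m) ?_
  intro g' hg'
  rw [LinearMap.zero_apply, LinearMap.zero_apply]
  rcases hg with ⟨y, hy, rfl⟩ | hg <;> rcases hg' with ⟨y', hy', rfl⟩ | hg'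
  · rcases lt_trichotomy y y' with hlt | rfl | hlt
    · rw [defect_swap, D.defect_upper_e hy (D.isUpper_e hlt m), neg_zero]
    · exact hself _
    · exact D.defect_upper_e hy' (D.isUpper_e hlt m)
  · rw [defect_swap, D.defect_upper_e hy (hup _ _ hy hg'), neg_zero]
  · exact D.defect_upper_e hy' (hup _ _ hy' hg)
  · exact h _ _ hg hg'

theorem defect_inr (w : N) (g h : G) : D.defect (incl k Y w) g h = 0 := by
  rw [defect_apply]
  simp only [act_inr, D.ρ_lie, map_sub, sub_self]

/-- For upper `u` and `u'` and `m = z m'`, both `u · (u' · m)` and `u' · (u · m)` are expanded by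
moving `z` to the left; the difference is `[u, u'] · m` by the Jacobi identity. -/
theorem defect_mon (n : ℕ) : ∀ m : Multiset Y, m.card = n → D.defect (mon m) = 0 := by
  induction n using Nat.strong_induction_on with
  | _ n ih =>
  intro m hm
  refine D.defect_eq_zero_of_upper fun u u' hu hu' => ?_
  by_cases hm0 : m = 0
  · subst hm0
    have h1 := hu.coord_eq_zero
    have h2 := hu'.coord_eq_zero
    have h3 := D.coord_lie _ _ h1 h2
    rw [defect_apply, D.act_zero h1, D.act_zero h2, D.act_zero h3, D.χ_lie _ _ h1 h2,
      D.μ_lie _ _ h1 h2]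
    simp only [map_add, map_smul, act_inr, D.act_zero h1, D.act_zero h2, D.ρ_v _ h1, D.ρ_v _ h2]
    module
  · obtain ⟨z, m, rfl, hz⟩ := exists_min_cons hm0
    rw [Multiset.card_cons] at hm
    have ihm : ∀ g h, D.act g (D.act h (mon m)) =
        D.act h (D.act g (mon m)) + D.act ⁅g, h⁆ (mon m) := by
      intro g h
      have := LinearMap.congr_fun (LinearMap.congr_fun (ih m.card (by omega) m rfl) g) h
      rw [defect_apply, LinearMap.zero_apply, LinearMap.zero_apply, sub_eq_zero] at this
      rw [← this]; abel
    -- the commutator of `u` and `e z` at `u' · m`: by induction in degrees up to that of `m`, and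
    -- by `defect_upper_e` on the leading term
    have key : ∀ u u', D.IsUpper (z ::ₘ m) u → D.IsUpper (z ::ₘ m) u' →
        D.act u (D.act (D.e z) (D.act u' (mon m))) =
          D.act (D.e z) (D.act u (D.act u' (mon m))) + D.act ⁅u, D.e z⁆ (D.act u' (mon m)) := by
      intro u u' hu hu'
      suffices ∀ x, x = D.act u' (mon m) - D.top m u' ∨ x = D.top m u' →
          (D.act u ∘ₗ D.act (D.e z)) x = (D.act (D.e z) ∘ₗ D.act u + D.act ⁅u, D.e z⁆) x by
        have h1 := congrArg₂ (· + ·) (this _ (Or.inl rfl)) (this _ (Or.inr rfl))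
        simp only [← map_add, sub_add_cancel] at h1
        exact h1
      have aux : ∀ x, D.defect x u (D.e z) = 0 →
          (D.act u ∘ₗ D.act (D.e z)) x = (D.act (D.e z) ∘ₗ D.act u + D.act ⁅u, D.e z⁆) x := by
        intro x hx
        rw [defect_apply] at hx
        simp only [LinearMap.comp_apply, LinearMap.add_apply]
        rw [← sub_eq_zero, ← hx]; abel
      rintro x (rfl | rfl)
      · refine eq_on_filt (fun m' hm' => aux _ ?_) (fun w => aux _ (D.defect_inr w _ _))
          (D.act_sub_top_mem u' m)
        rw [ih m'.card (by omega) m' rfl]; rfl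
      · refine D.map_top_eq hz (fun y hy => aux _ ?_) hu'
        exact D.defect_upper_e (le_cons hy hz) (D.isUpper_cons hu hz)
    rw [defect_apply, D.act_cons hz hu, D.act_cons hz hu', map_add, map_add, key u u' hu hu',
      key u' u hu' hu, ihm u ⁅u', D.e z⁆, ihm u' ⁅u, D.e z⁆, ihm u u', map_add, ← D.act_e hz,
      ihm ⁅u, u'⁆ (D.e z)]
    have hj : ⁅⁅u, u'⁆, D.e z⁆ = ⁅u, ⁅u', D.e z⁆⁆ - ⁅u', ⁅u, D.e z⁆⁆ := lie_lie u u' (D.e z)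
    rw [hj, map_sub, LinearMap.sub_apply]
    abel

theorem act_lie (g h : G) : D.act ⁅g, h⁆ = D.act g * D.act h - D.act h * D.act g := by
  refine ext_mon (fun m => ?_) (fun w => ?_)
  · have := LinearMap.congr_fun (LinearMap.congr_fun (D.defect_mon _ m rfl) g) h
    rw [defect_apply, LinearMap.zero_apply, LinearMap.zero_apply, sub_eq_zero] at this
    exact this.symm
  · exact (sub_eq_zero.mp (D.defect_inr w g h)).symm

attribute [local instance 100] LieRing.ofAssociativeRing in
/-- The representation of `G` on `k[Y] ⊕ N`. -/
def rep : G →ₗ⁅k⁆ Module.End k (Space k N Y) where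
  toLinearMap := D.act
  map_lie' {g h} := D.act_lie g h

end ExtensionDatum

/-! ### Universal enveloping algebras -/

open LieAlgebra LieAlgebra.IsKilling LieModule CategoryTheory

section UniversalEnvelopingAlgebra

theorem universalEnvelopingAlgebra_mkAlgHom_surjective {k L : Type*} [CommRing k] [LieRing L]
    [LieAlgebra k L] : Function.Surjective (UniversalEnvelopingAlgebra.mkAlgHom k L) :=
  RingCon.mk'_surjective _

theorem universalEnvelopingAlgebra_induction {k L : Type*} [CommRing k] [LieRing L]
    [LieAlgebra k L] {p : UniversalEnvelopingAlgebra k L → Prop}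
    (algebraMap : ∀ r, p (algebraMap k _ r)) (ι : ∀ x, p (UniversalEnvelopingAlgebra.ι k x))
    (mul : ∀ a b, p a → p b → p (a * b)) (add : ∀ a b, p a → p b → p (a + b))
    (a : UniversalEnvelopingAlgebra k L) : p a := by
  obtain ⟨t, rfl⟩ := universalEnvelopingAlgebra_mkAlgHom_surjective a
  induction t using TensorAlgebra.induction with
  | algebraMap r => rw [AlgHom.commutes]; exact algebraMap r
  | ι x => exact ι x
  | mul a b ha hb => rw [map_mul]; exact mul _ _ ha hb
  | add a b ha hb => rw [map_add]; exact add _ _ ha hb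

attribute [local instance 100] LieRing.ofAssociativeRing in
theorem commute_ι_of_lie_eq_zero {k L : Type*} [CommRing k] [LieRing L]
    [LieAlgebra k L] {c : L} (hc : ∀ x : L, ⁅c, x⁆ = 0) (a : UniversalEnvelopingAlgebra k L) :
    Commute (UniversalEnvelopingAlgebra.ι k c) a := by
  induction a using universalEnvelopingAlgebra_induction with
  | algebraMap r => exact (Algebra.commutes r _).symm
  | ι x =>
    have h := LieHom.map_lie (UniversalEnvelopingAlgebra.ι k) c x
    rw [hc, map_zero, LieRing.of_associative_ring_bracket] at h
    exact (sub_eq_zero.mp h.symm)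
  | mul a b ha hb => exact ha.mul_right hb
  | add a b ha hb => exact ha.add_right hb

theorem rank_universalEnvelopingAlgebra_le {L : Type u} [LieRing L]
    [LieAlgebra ℂ L] (h : Module.rank ℂ L ≤ Cardinal.aleph0) :
    Module.rank ℂ (UniversalEnvelopingAlgebra ℂ L) ≤ Cardinal.aleph0 := by
  refine (LinearMap.rank_le_of_surjective (UniversalEnvelopingAlgebra.mkAlgHom ℂ L).toLinearMap
    universalEnvelopingAlgebra_mkAlgHom_surjective).trans ?_
  rw [TensorAlgebra.rank_eq, Cardinal.lift_le_aleph0]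
  refine (Cardinal.sum_le_sum _ (fun _ => Cardinal.aleph0) fun n => ?_).trans (by simp)
  exact Cardinal.power_nat_le_max.trans (max_le h le_rfl)

end UniversalEnvelopingAlgebra

theorem central_lie {𝔤 : Type u} [LieRing 𝔤] [LieAlgebra ℂ 𝔤] (x : Affine 𝔤) :
    ⁅(Affine.central : Affine 𝔤), x⁆ = 0 := by
  ext <;> simp [Affine.central]

/-! ### The generator of the induced module -/

section Generator

theorem levelProj_surjective (𝔤 : Type u) [LieRing 𝔤] [LieAlgebra ℂ 𝔤] (θ : ℂ) :
    Function.Surjective (levelProj 𝔤 θ) := RingCon.mk'_surjective _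

variable {𝔤 : Type u} [LieRing 𝔤] [LieAlgebra ℂ 𝔤] [FiniteDimensional ℂ 𝔤] [IsKilling ℂ 𝔤]
  {H : LieSubalgebra ℂ 𝔤} [H.IsCartanSubalgebra] {b : (rootSystem H).Base}
  (P : Parabolic b) (X : RootVectors H) (Λ : P.genRoots → ℤ → ℂ) (θ : ℂ)

/-- The generator `1 ⊗ 1` of `M(Λ, θ)`. -/
def genVec : inducedWhittaker P X Λ θ :=
  (Submodule.Quotient.mk ((1 : LevelAlgebra 𝔤 θ) ⊗ₜ[ℂ] (show CharModule _ from (1 : ℂ))) :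
    BaseExtension (nilToLevel θ P) (CharModule (P.whittakerCharacter X Λ)))

theorem smul_genVec (u : UniversalEnvelopingAlgebra ℂ (Affine 𝔤)) :
    u • genVec P X Λ θ =
    (Submodule.Quotient.mk (levelProj 𝔤 θ u ⊗ₜ[ℂ] (show CharModule _ from (1 : ℂ))) :
    BaseExtension (nilToLevel θ P) (CharModule (P.whittakerCharacter X Λ))) := by
  have h : u • genVec P X Λ θ = (Submodule.Quotient.mk (levelProj 𝔤 θ u •
      ((1 : LevelAlgebra 𝔤 θ) ⊗ₜ[ℂ] (show CharModule (P.whittakerCharacter X Λ) from (1 : ℂ)))) :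
    BaseExtension (nilToLevel θ P) (CharModule (P.whittakerCharacter X Λ))) := rfl
  rw [h, TensorProduct.smul_tmul', smul_eq_mul, mul_one]

theorem exists_smul_genVec (m : inducedWhittaker P X Λ θ) :
    ∃ u : UniversalEnvelopingAlgebra ℂ (Affine 𝔤), u • genVec P X Λ θ = m := by
  obtain ⟨t, rfl⟩ := Submodule.Quotient.mk_surjective _ m
  induction t using TensorProduct.induction_on with
  | zero => exact ⟨0, zero_smul _ _⟩
  | add x y hx hy =>
    obtain ⟨u, hu⟩ := hx
    obtain ⟨w, hw⟩ := hy
    refine ⟨u + w, ?_⟩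
    rw [add_smul, hu, hw]; rfl
  | tmul b n =>
    obtain ⟨u, rfl⟩ := levelProj_surjective 𝔤 θ b
    refine ⟨(show ℂ from n) • u, ?_⟩
    rw [smul_genVec, map_smul, ← TensorProduct.smul_tmul', ← TensorProduct.tmul_smul]
    congr 2
    exact mul_one (show ℂ from n)

theorem nil_smul_genVec (f : Loop P.nil) :
    (UniversalEnvelopingAlgebra.ι ℂ (P.loopNilIncl f) -
      algebraMap ℂ _ (P.whittakerCharacter X Λ f)) • genVec P X Λ θ = 0 := by
  rw [smul_genVec]
  refine (Submodule.Quotient.mk_eq_zero _).mpr (Submodule.subset_span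
    ⟨1, UniversalEnvelopingAlgebra.ι ℂ f, (show ℂ from 1), ?_⟩)
  have h1 : nilToLevel θ P (UniversalEnvelopingAlgebra.ι ℂ f) =
      levelProj 𝔤 θ (UniversalEnvelopingAlgebra.ι ℂ (P.loopNilIncl f)) := by
    rw [nilToLevel, AlgHom.comp_apply, UniversalEnvelopingAlgebra.lift_ι_apply]; rfl
  have h2 : UniversalEnvelopingAlgebra.ι ℂ f •
      (show CharModule (P.whittakerCharacter X Λ) from (1 : ℂ)) =
        P.whittakerCharacter X Λ f • (show CharModule (P.whittakerCharacter X Λ) from (1 : ℂ)) := by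
    change UniversalEnvelopingAlgebra.lift ℂ (P.whittakerCharacter X Λ)
      (UniversalEnvelopingAlgebra.ι ℂ f) * (1 : ℂ) = P.whittakerCharacter X Λ f * (1 : ℂ)
    rw [UniversalEnvelopingAlgebra.lift_ι_apply]
  refine Eq.trans ?_ (congrArg₂ (fun x y => x - (1 : LevelAlgebra 𝔤 θ) ⊗ₜ[ℂ] y)
    (congrArg (· ⊗ₜ[ℂ] _) ((one_mul _).trans h1).symm) h2.symm)
  rw [map_sub, TensorProduct.sub_tmul, AlgHom.commutes, Algebra.algebraMap_eq_smul_one,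
    TensorProduct.smul_tmul]

theorem central_smul_genVec :
    (UniversalEnvelopingAlgebra.ι ℂ (Affine.central : Affine 𝔤) -
      algebraMap ℂ _ θ) • genVec P X Λ θ = 0 := by
  rw [smul_genVec]
  have : levelProj 𝔤 θ (UniversalEnvelopingAlgebra.ι ℂ (Affine.central : Affine 𝔤) -
      algebraMap ℂ _ θ) = 0 := by
    refine Quotient.sound ?_
    have := TwoSidedIdeal.subset_span (R := UniversalEnvelopingAlgebra ℂ (Affine 𝔤))
      (Set.mem_singleton (UniversalEnvelopingAlgebra.ι ℂ (Affine.central : Affine 𝔤) -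
        algebraMap ℂ (UniversalEnvelopingAlgebra ℂ (Affine 𝔤)) θ))
    exact (TwoSidedIdeal.mem_iff _ _).mp this
  rw [this, TensorProduct.zero_tmul]
  rfl

/-- The universal property of `M(Λ, θ)`, in terms of annihilators: if the class of `e` in
the `U(𝔤^)`-module `E / R` satisfies `c e = θ e` and `x e = Λ(x) e` for `x ∈ L(𝔫)`, then it is
killed by the annihilator of the generator of `M(Λ, θ)`. -/
theorem mem_of_smul_genVec_eq_zero {E : Type*} [AddCommGroup E] [Module ℂ E]
    (ρ : UniversalEnvelopingAlgebra ℂ (Affine 𝔤) →ₐ[ℂ] Module.End ℂ E) (R : Submodule ℂ E)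
    (hR : ∀ u, ∀ x ∈ R, ρ u x ∈ R) (e : E)
    (hc : ρ (UniversalEnvelopingAlgebra.ι ℂ Affine.central) e - θ • e ∈ R)
    (hx : ∀ f : Loop P.nil, ρ (UniversalEnvelopingAlgebra.ι ℂ (P.loopNilIncl f)) e -
      P.whittakerCharacter X Λ f • e ∈ R)
    {u : UniversalEnvelopingAlgebra ℂ (Affine 𝔤)} (hu : u • genVec P X Λ θ = 0) :
    ρ u e ∈ R := by
  let φ : UniversalEnvelopingAlgebra ℂ (Affine 𝔤) →ₗ[ℂ] E ⧸ R :=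
    R.mkQ ∘ₗ ρ.toLinearMap.flip e
  have hφ : ∀ w, φ w = 0 ↔ ρ w e ∈ R := fun w => Submodule.Quotient.mk_eq_zero R
  -- `φ` factors through `U_θ`, as `c` is central in `U(𝔤^)`
  have hker : LinearMap.ker (levelProj 𝔤 θ).toLinearMap ≤ LinearMap.ker φ := by
    intro w hw
    -- the annihilator of the submodule generated by the class of `e`
    let J : TwoSidedIdeal (UniversalEnvelopingAlgebra ℂ (Affine 𝔤)) :=
      TwoSidedIdeal.mk' {w | ∀ a, ρ (w * a) e ∈ R}
        (by intro a; simp)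
        (by intro x y hx hy a; rw [add_mul, map_add]; exact add_mem (hx a) (hy a))
        (by intro x hx a; rw [neg_mul, map_neg]; exact neg_mem (hx a))
        (by intro x y hy a; rw [mul_assoc, map_mul]; exact hR _ _ (hy a))
        (by intro x y hx a; rw [mul_assoc]; exact hx _)
    have hJ : TwoSidedIdeal.span {UniversalEnvelopingAlgebra.ι ℂ (Affine.central : Affine 𝔤) -
        algebraMap ℂ (UniversalEnvelopingAlgebra ℂ (Affine 𝔤)) θ} ≤ J := by
      rw [TwoSidedIdeal.span_le, Set.singleton_subset_iff]
      refine (TwoSidedIdeal.mem_mk' ..).mpr fun a => ?_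
      have hcomm := ((commute_ι_of_lie_eq_zero (k := ℂ) central_lie a).sub_left
        (Algebra.commutes θ a))
      rw [hcomm.eq, map_mul]
      refine hR _ _ ?_
      simpa using hc
    have h1 : w ∈ J := by
      refine hJ ((TwoSidedIdeal.mem_iff _ _).mpr ?_)
      exact Quotient.exact (LinearMap.mem_ker.mp hw)
    have h2 := (TwoSidedIdeal.mem_mk' ..).mp h1 1
    rw [mul_one] at h2
    exact (hφ w).mpr h2
  obtain ⟨Φ, hΦ⟩ : ∃ Φ : LevelAlgebra 𝔤 θ →ₗ[ℂ] E ⧸ R, ∀ w, Φ (levelProj 𝔤 θ w) = φ w := by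
    let q := (levelProj 𝔤 θ).toLinearMap.quotKerEquivOfSurjective (levelProj_surjective 𝔤 θ)
    refine ⟨(Submodule.liftQ _ φ hker) ∘ₗ q.symm.toLinearMap, fun w => ?_⟩
    have : q.symm (levelProj 𝔤 θ w) = Submodule.Quotient.mk w := by
      rw [LinearEquiv.symm_apply_eq]; rfl
    rw [LinearMap.comp_apply, LinearEquiv.coe_coe, this]
    rfl
  have hA : ∀ a : UniversalEnvelopingAlgebra ℂ (Loop P.nil), ∃ a',
      nilToLevel θ P a = levelProj 𝔤 θ a' ∧
      ρ a' e - UniversalEnvelopingAlgebra.lift ℂ (P.whittakerCharacter X Λ) a • e ∈ R := by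
    intro a
    induction a using universalEnvelopingAlgebra_induction with
    | algebraMap r =>
      refine ⟨algebraMap ℂ _ r, by simp, ?_⟩
      simp
    | ι f =>
      refine ⟨UniversalEnvelopingAlgebra.ι ℂ (P.loopNilIncl f), ?_, ?_⟩
      · rw [nilToLevel, AlgHom.comp_apply, UniversalEnvelopingAlgebra.lift_ι_apply]; rfl
      · rw [UniversalEnvelopingAlgebra.lift_ι_apply]; exact hx f
    | mul a₁ a₂ h₁ h₂ =>
      obtain ⟨a₁', e₁, m₁⟩ := h₁
      obtain ⟨a₂', e₂, m₂⟩ := h₂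
      refine ⟨a₁' * a₂', by rw [map_mul, map_mul, e₁, e₂], ?_⟩
      have h3 := add_mem (hR a₁' _ m₂) (R.smul_mem
        (UniversalEnvelopingAlgebra.lift ℂ (P.whittakerCharacter X Λ) a₂) m₁)
      convert h3 using 1
      rw [map_mul, map_mul, Module.End.mul_apply, map_sub, map_smul]
      module
    | add a₁ a₂ h₁ h₂ =>
      obtain ⟨a₁', e₁, m₁⟩ := h₁
      obtain ⟨a₂', e₂, m₂⟩ := h₂
      refine ⟨a₁' + a₂', by rw [map_add, map_add, e₁, e₂], ?_⟩
      convert add_mem m₁ m₂ using 1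
      rw [map_add, map_add, LinearMap.add_apply]
      module
  have hΦA : ∀ (w : LevelAlgebra 𝔤 θ) (a), Φ (w * nilToLevel θ P a) =
      UniversalEnvelopingAlgebra.lift ℂ (P.whittakerCharacter X Λ) a • Φ w := by
    intro w a
    obtain ⟨w, rfl⟩ := levelProj_surjective 𝔤 θ w
    obtain ⟨a', ha, hm⟩ := hA a
    rw [ha, ← map_mul, hΦ, hΦ, ← sub_eq_zero, ← map_smul, ← map_sub, hφ]
    convert hR w _ hm using 1
    simp
  let T : LevelAlgebra 𝔤 θ ⊗[ℂ] CharModule (P.whittakerCharacter X Λ) →ₗ[ℂ] E ⧸ R :=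
    TensorProduct.lift ((LinearMap.lsmul ℂ (E ⧸ R)).flip ∘ₗ Φ :
      LevelAlgebra 𝔤 θ →ₗ[ℂ] ℂ →ₗ[ℂ] E ⧸ R)
  have hT : ∀ w (n : ℂ), T (w ⊗ₜ[ℂ] (show CharModule _ from n)) = n • Φ w := fun w n => rfl
  rw [smul_genVec] at hu
  have hu' := (Submodule.Quotient.mk_eq_zero _).mp hu
  have hkill : ∀ z ∈ Submodule.span (LevelAlgebra 𝔤 θ) {z | ∃ (b : LevelAlgebra 𝔤 θ)
      (a : UniversalEnvelopingAlgebra ℂ (Loop P.nil)) (n : CharModule (P.whittakerCharacter X Λ)),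
      z = (b * nilToLevel θ P a) ⊗ₜ[ℂ] n - b ⊗ₜ[ℂ] (a • n)},
      ∀ w : LevelAlgebra 𝔤 θ, T (w • z) = 0 := by
    intro z hz
    induction hz using Submodule.span_induction with
    | zero => simp
    | add x y _ _ hx hy => intro w; rw [smul_add, map_add, hx, hy, add_zero]
    | smul r x _ hx => intro w; rw [smul_smul]; exact hx _
    | mem z hz =>
      obtain ⟨b, a, n, rfl⟩ := hz
      intro w
      rw [smul_sub, TensorProduct.smul_tmul', TensorProduct.smul_tmul', map_sub, smul_eq_mul,
        smul_eq_mul, ← mul_assoc]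
      refine sub_eq_zero.mpr ((hT _ (show ℂ from n)).trans ?_)
      refine Eq.trans ?_ (hT _ (UniversalEnvelopingAlgebra.lift ℂ (P.whittakerCharacter X Λ) a *
        (show ℂ from n))).symm
      rw [hΦA, smul_smul, mul_comm]
  have h1 := hkill _ hu' 1
  rw [one_smul, hT, one_smul, hΦ, hφ] at h1
  exact h1

end Generator

/-! ### Heights, and roots of the nilradical outside its derived algebra -/

section Height

theorem mem_rootSpace_zero {𝔤 : Type u} [LieRing 𝔤] [LieAlgebra ℂ 𝔤] [FiniteDimensional ℂ 𝔤]
    {H : LieSubalgebra ℂ 𝔤} [H.IsCartanSubalgebra] {x : 𝔤} (hx : x ∈ H) :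
    x ∈ rootSpace H (0 : H → ℂ) := by
  rwa [rootSpace_zero_eq, LieSubalgebra.mem_toLieSubmodule]

theorem mem_cartan_of_mem_rootSpace_zero {𝔤 : Type u} [LieRing 𝔤] [LieAlgebra ℂ 𝔤]
    [FiniteDimensional ℂ 𝔤] {H : LieSubalgebra ℂ 𝔤} [H.IsCartanSubalgebra] {x : 𝔤}
    (hx : x ∈ rootSpace H (0 : H → ℂ)) : x ∈ H := by
  rwa [rootSpace_zero_eq, LieSubalgebra.mem_toLieSubmodule] at hx

variable {𝔤 : Type u} [LieRing 𝔤] [LieAlgebra ℂ 𝔤] [FiniteDimensional ℂ 𝔤] [IsKilling ℂ 𝔤]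
  {H : LieSubalgebra ℂ 𝔤} [H.IsCartanSubalgebra] (b : (rootSystem H).Base)

/-- The sum of all root spaces for roots of height at least `m`; for `m = 1` this is `𝔫₊`. -/
def heightGE (m : ℤ) : Submodule ℂ 𝔤 :=
  Submodule.span ℂ {x | ∃ α : H.root, m ≤ b.height α ∧ x ∈ rootSpace H α.1}

theorem mem_heightGE {m : ℤ} {α : H.root} (hα : m ≤ b.height α) {x : 𝔤}
    (hx : x ∈ rootSpace H α.1) : x ∈ heightGE b m := Submodule.subset_span ⟨α, hα, hx⟩

theorem heightGE_antitone {m m' : ℤ} (h : m ≤ m') : heightGE b m' ≤ heightGE b m :=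
  Submodule.span_mono fun _ ⟨α, hα, hx⟩ => ⟨α, h.trans hα, hx⟩

theorem coeff_heightGE (X : RootVectors H) {m : ℤ} {α : H.root} (hα : b.height α < m) {x : 𝔤}
    (hx : x ∈ heightGE b m) : X.coeff α x = 0 := by
  suffices heightGE b m ≤ LinearMap.ker (X.coeff α) from this hx
  refine Submodule.span_le.mpr ?_
  rintro x ⟨β, hβ, hx⟩
  refine X.coeff_of_ne (fun h => ?_) hx
  have : β = α := Subtype.ext (DFunLike.coe_injective h)
  subst this
  omega

theorem exists_heightGE_eq_bot : ∃ m : ℕ, heightGE b m = ⊥ := by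
  obtain ⟨m, hm⟩ := (Set.finite_range b.height).bddAbove
  refine ⟨(m + 1).toNat, ?_⟩
  rw [heightGE, Submodule.span_eq_bot]
  rintro x ⟨α, hα, -⟩
  have := hm ⟨α, rfl⟩
  omega

theorem lie_mem_heightGE {m m' : ℤ} (hm : 0 < m) (hm' : 0 < m') {x y : 𝔤}
    (hx : x ∈ heightGE b m) (hy : y ∈ heightGE b m') : ⁅x, y⁆ ∈ heightGE b (m + m') := by
  induction hx using Submodule.span_induction with
  | zero => simp
  | add x x' _ _ h h' => rw [add_lie]; exact add_mem h h'
  | smul c x _ h => rw [smul_lie]; exact Submodule.smul_mem _ _ h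
  | mem x hx =>
    induction hy using Submodule.span_induction with
    | zero => simp
    | add y y' _ _ h h' => rw [lie_add]; exact add_mem h h'
    | smul c y _ h => rw [lie_smul]; exact Submodule.smul_mem _ _ h
    | mem y hy =>
      obtain ⟨α, hα, hx⟩ := hx
      obtain ⟨β, hβ, hy⟩ := hy
      have hxy : ⁅x, y⁆ ∈ rootSpace H (α.1 + β.1 : H → ℂ) :=
        lie_mem_genWeightSpace_of_mem_genWeightSpace hx hy
      by_cases h0 : ⁅x, y⁆ = 0
      · rw [h0]; exact zero_mem _
      let χ : Weight ℂ H 𝔤 := ⟨α.1 + β.1, fun h => h0 ((LieSubmodule.mem_bot _).mp (h.le hxy))⟩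
      have hχ0 : χ.toLinear = α.1.toLinear + β.1.toLinear := rfl
      by_cases hχ : χ.IsZero
      · have h1 : (rootSystem H).root β = -(rootSystem H).root α := by
          rw [rootSystem_root_apply, rootSystem_root_apply]
          rw [eq_neg_iff_add_eq_zero, add_comm, ← hχ0]
          ext h
          exact congrFun hχ h
        have h2 := b.height_reflectionPerm_self α
        have h3 : (rootSystem H).reflectionPerm α α = β := by
          apply (rootSystem H).root.injective
          rw [h1, RootPairing.root_reflectionPerm, RootPairing.reflection_apply_self]
        have h4 : b.height ((rootSystem H).reflectionPerm α α) = -b.height α := h2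
        rw [h3] at h4
        omega
      · let γ : H.root := ⟨χ, by simpa using hχ⟩
        have h1 : b.height γ = b.height α + b.height β := by
          refine b.height_add ?_
          simp only [rootSystem_root_apply]
          exact hχ0
        exact mem_heightGE b (α := γ) (by omega) hxy

theorem exists_neg_root (α : H.root) : ∃ β : H.root, b.height β = -b.height α ∧
    (β.1 : H → ℂ) = -α.1 := by
  refine ⟨(rootSystem H).reflectionPerm α α, b.height_reflectionPerm_self α, ?_⟩
  have h1 := (rootSystem H).root_reflectionPerm α α
  rw [RootPairing.reflection_apply_self, rootSystem_root_apply, rootSystem_root_apply] at h1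
  funext h
  exact LinearMap.congr_fun h1 h

theorem eq_zero_of_killingForm {χ : H → ℂ} {x : 𝔤} (hx : x ∈ rootSpace H χ)
    (h : ∀ y ∈ rootSpace H (-χ), killingForm ℂ 𝔤 x y = 0) : x = 0 := by
  simpa using mem_ker_killingForm_of_mem_rootSpace_of_forall_rootSpace_neg ℂ 𝔤 H hx h

theorem eq_zero_of_mem_heightGE_of_mem_cartan {x : 𝔤} {m : ℤ} (hx : x ∈ heightGE b m)
    (h : x ∈ rootSpace H (0 : H → ℂ)) : x = 0 := by
  refine eq_zero_of_killingForm h fun y hy => ?_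
  suffices heightGE b m ≤ LinearMap.ker ((killingForm ℂ 𝔤).flip y) from this hx
  refine Submodule.span_le.mpr ?_
  rintro x ⟨α, -, hx⟩
  refine killingForm_apply_eq_zero_of_mem_rootSpace_of_add_ne_zero ℂ 𝔤 H hx hy fun h => ?_
  rw [neg_zero, add_zero] at h
  exact H.isNonZero_coe_root α h

theorem le_heightGE (N : LieSubmodule ℂ H 𝔤) {m : ℤ}
    (h0 : ∀ x ∈ N, x ∈ H → x = 0)
    (h : ∀ α : H.root, b.height α < m → ∀ x ∈ N, x ∈ rootSpace H α.1 → x = 0) :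
    N.toSubmodule ≤ heightGE b m := by
  intro x hx
  replace hx := (LieModule.eq_iSup_inf_genWeightSpace ℂ H 𝔤 N).le hx
  induction hx using LieSubmodule.iSup_induction' with
  | zero => exact zero_mem _
  | add x x' _ _ h h' => exact add_mem h h'
  | mem χ x hx =>
    obtain ⟨hxN, hxχ⟩ := hx
    by_cases hχ : χ.IsZero
    · rw [h0 x hxN (mem_cartan_of_mem_rootSpace_zero (by rw [← hχ.eq]; exact hxχ))]
      exact zero_mem _
    · let α : H.root := ⟨χ, by simpa using hχ⟩
      by_cases hα : m ≤ b.height α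
      · exact mem_heightGE b hα hxχ
      · rw [h α (by omega) x hxN hxχ]
        exact zero_mem _

end Height

namespace Parabolic
variable {𝔤 : Type u} [LieRing 𝔤] [LieAlgebra ℂ 𝔤] [FiniteDimensional ℂ 𝔤] [IsKilling ℂ 𝔤]
  {H : LieSubalgebra ℂ 𝔤} [H.IsCartanSubalgebra] {b : (rootSystem H).Base} (P : Parabolic b)

theorem heightGE_one_le : heightGE b 1 ≤ P.alg.toSubmodule := by
  refine Submodule.span_le.mpr ?_
  rintro x ⟨α, hα, hx⟩
  exact P.rootSpace_le α (b.isPos_iff.mpr (by omega)) x hx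

/-- The orthogonal of `𝔭` for the Killing form, as an `𝔥`-submodule of `𝔤`. -/
def orthogonal : LieSubmodule ℂ H 𝔤 where
  carrier := {x | ∀ y ∈ P.alg, killingForm ℂ 𝔤 x y = 0}
  add_mem' := fun {x x'} hx hx' y hy => by
    rw [map_add, LinearMap.add_apply, hx y hy, hx' y hy, add_zero]
  zero_mem' := fun y _ => by rw [map_zero, LinearMap.zero_apply]
  smul_mem' := fun c x hx y hy => by
    rw [map_smul, LinearMap.smul_apply, hx y hy, smul_zero]
  lie_mem := fun {h x} hx y hy => by
    have h1 : ⁅(h : 𝔤), x⁆ = -⁅x, (h : 𝔤)⁆ := (lie_skew _ _).symm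
    change killingForm ℂ 𝔤 ⁅(h : 𝔤), x⁆ y = 0
    rw [h1, map_neg, LinearMap.neg_apply, LieModule.traceForm_apply_lie_apply,
      hx _ (P.alg.lie_mem (P.cartan_le h.2) hy), neg_zero]

theorem orthogonal_le : P.orthogonal.toSubmodule ≤ heightGE b 1 := by
  refine le_heightGE b _ (fun x hx hxH => ?_) (fun α hα x hx hxα => ?_)
  · refine eq_zero_of_killingForm (mem_rootSpace_zero hxH) fun y hy => hx y (P.cartan_le ?_)
    rw [neg_zero] at hy
    exact mem_cartan_of_mem_rootSpace_zero hy
  · obtain ⟨β, hβ, hβα⟩ := exists_neg_root b α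
    have := b.height_ne_zero α
    refine eq_zero_of_killingForm hxα fun y hy => hx y (P.rootSpace_le β
      (b.isPos_iff.mpr (by omega)) y (by rw [hβα]; exact hy))

/-- The intersection of `𝔭` with its orthogonal for the Killing form, as an ideal of `𝔭`. In fact
the orthogonal is contained in `𝔭`, by `orthogonal_le` and `heightGE_one_le`. -/
def orthogonalIdeal : LieIdeal ℂ P.alg where
  toSubmodule := P.orthogonal.toSubmodule.comap P.alg.toSubmodule.subtype
  lie_mem := fun {p x} hx y hy => by
    have h1 : ⁅(p : 𝔤), (x : 𝔤)⁆ = -⁅(x : 𝔤), (p : 𝔤)⁆ := (lie_skew _ _).symm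
    change killingForm ℂ 𝔤 ⁅(p : 𝔤), (x : 𝔤)⁆ y = 0
    rw [h1, map_neg, LinearMap.neg_apply, LieModule.traceForm_apply_lie_apply]
    exact neg_eq_zero.mpr (hx _ (P.alg.lie_mem p.2 hy))

theorem isNilpotent_orthogonalIdeal : LieRing.IsNilpotent P.orthogonalIdeal := by
  have key : ∀ k : ℕ, ∀ x ∈ lowerCentralSeries ℂ P.orthogonalIdeal P.orthogonalIdeal k,
      ((x : P.alg) : 𝔤) ∈ heightGE b (k + 1) := by
    intro k
    induction k with
    | zero =>
      intro x _
      rw [Nat.cast_zero, zero_add]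
      exact P.orthogonal_le x.2
    | succ k ih =>
      intro x hx
      rw [lowerCentralSeries_succ, ← LieSubmodule.mem_toSubmodule,
        LieSubmodule.lieIdeal_oper_eq_linear_span'] at hx
      induction hx using Submodule.span_induction with
      | zero => exact zero_mem _
      | add x y _ _ hx hy => exact add_mem hx hy
      | smul c x _ hx => exact Submodule.smul_mem _ c hx
      | mem x hx =>
        obtain ⟨y, -, z, hz, rfl⟩ := hx
        have h1 := lie_mem_heightGE b one_pos (by omega) (P.orthogonal_le y.2) (ih z hz)
        rw [add_comm] at h1
        push_cast
        exact h1
  obtain ⟨m, hm⟩ := exists_heightGE_eq_bot b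
  refine (LieModule.isNilpotent_iff ℂ _ _).mpr ⟨m, ?_⟩
  rw [eq_bot_iff]
  intro x hx
  have h1 := heightGE_antitone b (m := (m : ℤ)) (m' := m + 1) (by omega) (key m x hx)
  rw [hm, Submodule.mem_bot] at h1
  exact (LieSubmodule.mem_bot _).mpr (Subtype.ext (Subtype.ext h1))

theorem exists_mem_orthogonal : ∃ x ∈ P.orthogonal, x ≠ 0 := by
  have hlt : P.alg.toSubmodule < ⊤ := lt_top_iff_ne_top.mpr fun h =>
    P.ne_top ((LieSubalgebra.toSubmodule_inj _ _).mp h)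
  obtain ⟨f, hf0, hf⟩ := Submodule.exists_le_ker_of_lt_top _ hlt
  have hnd := LieAlgebra.IsKilling.killingForm_nondegenerate ℂ 𝔤
  let e := (killingForm ℂ 𝔤).toDual hnd
  refine ⟨e.symm f, fun y hy => ?_, fun h => hf0 (by simpa using h)⟩
  have h1 : killingForm ℂ 𝔤 (e.symm f) = f := e.apply_symm_apply f
  rw [h1]
  exact hf hy

theorem exists_mem_nil_ne_zero : ∃ x ∈ P.nil, x ≠ 0 := by
  obtain ⟨x, hx, hx0⟩ := P.exists_mem_orthogonal
  have hxp := P.heightGE_one_le (P.orthogonal_le hx)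
  refine ⟨x, P.mem_nil_iff.mpr ⟨hxp, ?_⟩, hx0⟩
  have h1 : P.orthogonalIdeal ≤ P.nilIdeal := le_sSup P.isNilpotent_orthogonalIdeal
  exact h1 (show (⟨x, hxp⟩ : P.alg) ∈ P.orthogonalIdeal from hx)

/-- The nilradical as an `𝔥`-submodule. -/
def nilSubmodule : LieSubmodule ℂ H 𝔤 where
  toSubmodule := P.nil.toSubmodule
  lie_mem := fun {h _} hx => P.lie_cartan_mem_nil h.2 hx

/-- If a nilpotent ideal contained `𝔤_α` for a negative root `α`, then it would contain the nonzero
subspace `[𝔤_α, 𝔤_{-α}]` of `𝔥`. -/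
theorem idealSubmodule_le {I : LieIdeal ℂ P.alg} (hI : LieRing.IsNilpotent I) :
    (P.idealSubmodule I).toSubmodule ≤ heightGE b 1 := by
  refine le_heightGE b _ (fun x hx hxH => P.eq_zero_of_mem_cartan hI hx hxH)
    (fun α hα x hx hxα => ?_)
  obtain ⟨β, hβ, hβα⟩ := exists_neg_root b α
  have hh := b.height_ne_zero α
  refine eq_zero_of_killingForm hxα fun y hy => ?_
  have hα0 := H.isNonZero_coe_root α
  have hlie := lie_eq_killingForm_smul_of_mem_rootSpace_of_mem_rootSpace_neg (α := α.1) hxα hy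
  have hyp : y ∈ P.alg := P.rootSpace_le β (b.isPos_iff.mpr (by omega)) y (by rw [hβα]; exact hy)
  have hmem : ⁅x, y⁆ ∈ P.idealSubmodule I := by
    obtain ⟨hxp, hxI⟩ := P.mem_idealSubmodule.mp hx
    exact P.mem_idealSubmodule.mpr ⟨P.alg.lie_mem hxp hyp,
      lie_mem_left ℂ P.alg I ⟨x, hxp⟩ ⟨y, hyp⟩ hxI⟩
  have h0 := P.eq_zero_of_mem_cartan hI hmem
    (by rw [hlie]; exact H.smul_mem _ (Submodule.coe_mem _))
  rw [hlie, smul_eq_zero] at h0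
  refine h0.resolve_right fun h1 => ?_
  have h2 := root_apply_cartanEquivDual_symm_ne_zero hα0
  have h3 : (cartanEquivDual H).symm α.1.toLinear = 0 := Subtype.ext h1
  exact h2 (by rw [h3, ← Weight.toLinear_apply, map_zero])

theorem nil_le : P.nil.toSubmodule ≤ heightGE b 1 := by
  intro x hx
  obtain ⟨hxp, hx⟩ := P.mem_nil_iff.mp hx
  suffices ∀ x ∈ P.nilIdeal, (x : 𝔤) ∈ heightGE b 1 from this _ hx
  intro x hx
  rw [nilIdeal, sSup_eq_iSup'] at hx
  induction hx using LieSubmodule.iSup_induction' with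
  | zero => exact zero_mem _
  | add x x' _ _ h h' => exact add_mem h h'
  | mem I x hx => exact P.idealSubmodule_le I.2 (P.mem_idealSubmodule.mpr ⟨x.2, hx⟩)

theorem rootSpace_le_nil {α : H.root} {x : 𝔤} (hx : x ∈ P.nil) (hxα : x ∈ rootSpace H α.1)
    (hx0 : x ≠ 0) : ∀ y ∈ rootSpace H α.1, y ∈ P.nil := by
  intro y hy
  obtain ⟨c, hc⟩ := (finrank_eq_one_iff_of_nonzero' (⟨x, hxα⟩ : rootSpace H α.1)
    (fun h => hx0 (congrArg Subtype.val h))).mp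
    (finrank_rootSpace_eq_one α.1 (H.isNonZero_coe_root α)) ⟨y, hy⟩
  have hc' : c • x = y := congrArg Subtype.val hc
  rw [← hc']
  exact P.nil.smul_mem _ hx

theorem genRoots_nonempty (X : RootVectors H) : P.genRoots.Nonempty := by
  let A : Set H.root := {α | ∀ x ∈ rootSpace H α.1, x ∈ P.nil}
  have h0 : ∀ x ∈ P.nilSubmodule, x ∈ H → x = 0 := fun x hx hxH =>
    eq_zero_of_mem_heightGE_of_mem_cartan b (P.nil_le hx) (mem_rootSpace_zero hxH)
  have hA : A.Nonempty := by
    by_contra hA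
    rw [Set.not_nonempty_iff_eq_empty] at hA
    obtain ⟨m, hm⟩ := exists_heightGE_eq_bot b
    have h1 := le_heightGE b P.nilSubmodule (m := m) h0 (fun α _ x hx hxα => by
      by_contra hx0
      have : α ∈ A := P.rootSpace_le_nil hx hxα hx0
      rw [hA] at this
      exact this)
    obtain ⟨x, hx, hx0⟩ := P.exists_mem_nil_ne_zero
    have h2 := h1 hx
    rw [hm] at h2
    exact hx0 h2
  obtain ⟨α, hα, hmin⟩ := Set.exists_min_image A b.height (Set.toFinite A) hA
  have hpos : 1 ≤ b.height α := by
    by_contra hlt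
    have h1 := coeff_heightGE b X (not_le.mp hlt) (P.nil_le (hα _ (X.mem α)))
    rw [X.coeff_self] at h1
    exact one_ne_zero h1
  have hle : P.nil.toSubmodule ≤ heightGE b (b.height α) :=
    le_heightGE b P.nilSubmodule h0 (fun β hβ x hx hxβ => by
      by_contra hx0
      have := hmin β (P.rootSpace_le_nil hx hxβ hx0)
      omega)
  refine ⟨α, hα, fun hD => ?_⟩
  have h1 : P.nilDerived ≤ heightGE b (b.height α + b.height α) := by
    refine Submodule.span_le.mpr ?_
    rintro _ ⟨x, hx, y, hy, rfl⟩
    exact lie_mem_heightGE b (by omega) (by omega) (hle hx) (hle hy)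
  have h2 := coeff_heightGE b X (α := α) (by omega) (h1 (hD _ (X.mem α)))
  rw [X.coeff_self] at h2
  exact one_ne_zero h2

end Parabolic

/-! ### A criterion for uncountable self-extensions -/

section ExtBound

open ModuleCat

variable {A : Type u} [Ring A] (M : ModuleCat.{u} A) (v : M)

/-- The annihilator of a vector, as a left ideal. -/
abbrev annIdeal : Submodule A A := LinearMap.ker (LinearMap.toSpanSingleton A M v)

/-- The sequence `0 → Ann(v) → A → M → 0`. -/
def annSequence : ShortComplex (ModuleCat.{u} A) :=
  ShortComplex.mk (ModuleCat.ofHom (annIdeal M v).subtype)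
    (ModuleCat.ofHom (LinearMap.toSpanSingleton A M v)) (by
      ext x
      exact x.2)

variable {M v}

theorem annSequence_shortExact (hgen : ∀ m : M, ∃ a : A, a • v = m) :
    (annSequence M v).ShortExact where
  exact := (ShortComplex.ShortExact.moduleCat_exact_iff_function_exact _).mpr (by
    intro x
    constructor
    · intro hx
      exact ⟨⟨x, hx⟩, rfl⟩
    · rintro ⟨y, rfl⟩
      exact y.2)
  mono_f := (ModuleCat.mono_iff_injective _).mpr Subtype.val_injective
  epi_g := (ModuleCat.epi_iff_surjective _).mpr hgen

variable [Algebra ℂ A]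

/-- The connecting map `Hom(Ann(v), M) → Ext¹(M, M)` of `0 → Ann(v) → A → M → 0`. -/
def connecting (hgen : ∀ m : M, ∃ a : A, a • v = m) :
    ((annSequence M v).X₁ ⟶ M) →ₗ[ℂ] Abelian.Ext.{u} M M 1 where
  toFun f := (annSequence_shortExact hgen).extClass.comp (Abelian.Ext.mk₀ f) (add_zero 1)
  map_add' f g := by rw [Abelian.Ext.mk₀_add, Abelian.Ext.comp_add]; rfl
  map_smul' c f := by rw [Abelian.Ext.mk₀_smul, Abelian.Ext.comp_smul]; rfl

/-- The restriction `M = Hom(A, M) → Hom(Ann(v), M)`. -/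
def restrictToAnn : M →ₗ[ℂ] ((annSequence M v).X₁ ⟶ M) where
  toFun m := ModuleCat.ofHom (LinearMap.toSpanSingleton A M m ∘ₗ (annIdeal M v).subtype)
  map_add' m m' := by
    ext x
    exact smul_add (x : annIdeal M v).1 m m'
  map_smul' c m := by
    ext x
    exact smul_comm (x : annIdeal M v).1 c m

theorem ker_connecting_le (hgen : ∀ m : M, ∃ a : A, a • v = m) :
    LinearMap.ker (connecting hgen) ≤ LinearMap.range (restrictToAnn (M := M) (v := v)) := by
  intro f hf
  obtain ⟨x, hx⟩ := Abelian.Ext.contravariant_sequence_exact₁ (annSequence_shortExact hgen) M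
    (Abelian.Ext.mk₀ f) (add_zero 1) hf
  obtain ⟨g, rfl⟩ := (Abelian.Ext.mk₀_bijective _ _).2 x
  rw [Abelian.Ext.mk₀_comp_mk₀] at hx
  have h1 := (Abelian.Ext.mk₀_bijective _ _).1 hx
  refine ⟨g.hom (1 : A), ?_⟩
  rw [← h1]
  ext y
  have h2 := g.hom.map_smul (y : annIdeal M v).1 (1 : A)
  exact h2.symm.trans (congrArg g.hom (mul_one (y : annIdeal M v).1))

/-- If `A` has countable dimension and the values of homomorphisms `Ann(v) → M` at some sequence
`x` in `Ann(v)` can be prescribed to be arbitrary multiples of `v`, then `Ext¹(M, M)` has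
uncountable dimension: its subspace `Hom(Ann(v), M) / M` has. -/
theorem aleph0_lt_rank_ext (hA : Module.rank ℂ A ≤ Cardinal.aleph0) (hv : v ≠ 0)
    (hgen : ∀ m : M, ∃ a : A, a • v = m) (x : ℤ → annIdeal M v)
    (hx : ∀ μ : ℤ → ℂ, ∃ f : annIdeal M v →ₗ[A] M, ∀ j, f (x j) = μ j • v) :
    Cardinal.aleph0 < Module.rank ℂ (Abelian.Ext.{u} M M 1) := by
  have hM : Module.rank ℂ M ≤ Cardinal.aleph0 := by
    refine (LinearMap.rank_le_of_surjective
      ((LinearMap.toSpanSingleton A M v).restrictScalars ℂ) hgen).trans hA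
  obtain ⟨l, hl⟩ : ∃ l : Module.Dual ℂ M, l v = 1 := by
    obtain ⟨l, hl⟩ := not_forall.mp (mt (Module.forall_dual_apply_eq_zero_iff ℂ v).mp hv)
    exact ⟨(l v)⁻¹ • l, by simp [hl]⟩
  let ev : ((annSequence M v).X₁ ⟶ M) →ₗ[ℂ] (ℤ → ℂ) :=
    { toFun := fun f j => l (f.hom (x j))
      map_add' := fun f g => by ext j; exact map_add l _ _
      map_smul' := fun c f => by ext j; exact map_smul l c _ }
  have hev : Function.Surjective ev := by
    intro μ
    obtain ⟨f, hf⟩ := hx μ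
    refine ⟨ModuleCat.ofHom f, funext fun j => ?_⟩
    change l (f (x j)) = μ j
    rw [hf, map_smul, hl, smul_eq_mul, mul_one]
  by_contra hcon
  have h1 : Module.rank ℂ ((annSequence M v).X₁ ⟶ M) ≤ Cardinal.aleph0 := by
    rw [← LinearMap.rank_range_add_rank_ker (connecting hgen)]
    refine Cardinal.add_le_aleph0.mpr ⟨(Submodule.rank_le _).trans (not_lt.mp hcon), ?_⟩
    exact (Submodule.rank_mono (ker_connecting_le hgen)).trans ((rank_range_le _).trans hM)
  have h2 := ev.lift_rank_le_of_surjective hev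
  rw [rank_fun_infinite] at h2
  have h3 : Cardinal.aleph0 < Cardinal.mk (ℤ → ℂ) := by
    simpa using Cardinal.aleph0_lt_continuum
  have h4 := h2.trans (Cardinal.lift_le_aleph0.mpr h1)
  rw [Cardinal.lift_le_aleph0] at h4
  exact absurd h3 (not_lt.mpr h4)

end ExtBound

theorem rank_affine_le (𝔤 : Type u) [LieRing 𝔤] [LieAlgebra ℂ 𝔤] [FiniteDimensional ℂ 𝔤] :
    Module.rank ℂ (Affine 𝔤) ≤ Cardinal.aleph0 := by
  let e : ((ℤ →₀ 𝔤) × ℂ × ℂ) →ₗ[ℂ] Affine 𝔤 :=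
    { toFun := fun x => ⟨(Loop.coeffs 𝔤).symm x.1, x.2.1, x.2.2⟩
      map_add' := fun x y => by ext <;> simp
      map_smul' := fun c x => by ext <;> simp }
  have he : Function.Surjective e := fun x =>
    ⟨(Loop.coeffs 𝔤 x.loop, x.dCoeff, x.cCoeff), by
      ext
      · exact (Loop.coeffs 𝔤).symm_apply_apply _
      · rfl
      · rfl⟩
  refine (LinearMap.rank_le_of_surjective e he).trans ?_
  have h1 : Cardinal.aleph0 * Module.rank ℂ 𝔤 ≤ Cardinal.aleph0 :=
    (mul_le_mul' le_rfl (Module.rank_lt_aleph0 ℂ 𝔤).le).trans_eq Cardinal.aleph0_mul_aleph0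
  rw [rank_prod]
  simpa using h1

/-! ### Modules over the affine Lie algebra extending `M(Λ, θ)` -/

section Extension

variable {𝔤 : Type u} [LieRing 𝔤] [LieAlgebra ℂ 𝔤] [FiniteDimensional ℂ 𝔤] [IsKilling ℂ 𝔤]
  {H : LieSubalgebra ℂ 𝔤} [H.IsCartanSubalgebra] {b : (rootSystem H).Base}
  (P : Parabolic b) (X : RootVectors H)

/-- A linear form on all of `𝔤^` that restricts to the character `Λ` on `L(𝔫)` and takes the value
`θ` at `c`. -/
def affineFunctional (Λ : P.genRoots → ℤ → ℂ) (θ : ℂ) : Affine 𝔤 →ₗ[ℂ] ℂ where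
  toFun x := (Finsupp.lsum ℂ fun j : ℤ => ∑ α : P.genRoots, Λ α j • X.coeff α)
    (Loop.coeffs 𝔤 x.loop) + θ * x.cCoeff
  map_add' x y := by simp only [Affine.add_loop, Affine.add_cCoeff, map_add, mul_add]; abel
  map_smul' c x := by
    simp only [Affine.smul_loop, Affine.smul_cCoeff, map_smul, smul_eq_mul, RingHom.id_apply]; ring

theorem affineFunctional_loopNilIncl (Λ : P.genRoots → ℤ → ℂ) (θ : ℂ) (f : Loop P.nil) :
    affineFunctional P X Λ θ (P.loopNilIncl f) = P.whittakerCharacter X Λ f := by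
  induction f using loop_induction with
  | h0 => simp
  | hadd f g hf hg => rw [map_add, map_add, map_add, hf, hg]
  | h x i =>
    change _ + θ * 0 = P.whittakerFunctional X Λ _
    rw [mul_zero, add_zero, P.whittakerFunctional_loopElt]
    change Finsupp.lsum ℂ _ (Loop.coeffs 𝔤 (P.loopNilMap _)) = _
    rw [P.loopNilMap_loopElt, coeffs_loopElt, Finsupp.lsum_single]
    simp

theorem affineFunctional_central (Λ : P.genRoots → ℤ → ℂ) (θ : ℂ) :
    affineFunctional P X Λ θ Affine.central = θ := by
  simp [affineFunctional, Affine.central]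

/-- The subalgebra `L(𝔫) ⊕ ℂ c` of `𝔤^`, as a subspace. -/
def nilCentral : Submodule ℂ (Affine 𝔤) :=
  LinearMap.range (P.loopNilIncl : Loop P.nil →ₗ[ℂ] Affine 𝔤) ⊔ ℂ ∙ Affine.central

variable {P} in
theorem mem_nilCentral {a : Affine 𝔤} : a ∈ nilCentral P ↔
    ∃ (f : Loop P.nil) (r : ℂ), P.loopNilIncl f + r • Affine.central = a := by
  simp [nilCentral, Submodule.mem_sup, Submodule.mem_span_singleton]

theorem lie_nilCentral (f g : Loop P.nil) (r s : ℂ) :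
    ⁅P.loopNilIncl f + r • Affine.central, P.loopNilIncl g + s • Affine.central⁆ =
      P.loopNilIncl ⁅f, g⁆ := by
  have h : ∀ x : Affine 𝔤, ⁅x, Affine.central⁆ = 0 := fun x => by
    rw [← lie_skew, central_lie, neg_zero]
  simp [add_lie, central_lie, h]

theorem whittakerCharacter_lie (Λ : P.genRoots → ℤ → ℂ) (f g : Loop P.nil) :
    P.whittakerCharacter X Λ ⁅f, g⁆ = 0 := P.whittakerFunctional_lie X Λ f g

/-- An index set for a basis of a complement of `L(𝔫) ⊕ ℂ c` in `𝔤^`. -/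
abbrev ComplementIndex : Type u := Module.Basis.ofVectorSpaceIndex ℂ (Affine 𝔤 ⧸ nilCentral P)

instance : LinearOrder (ComplementIndex P) := IsWellOrder.linearOrder WellOrderingRel

/-- The coordinates of an element of `𝔤^` modulo `L(𝔫) ⊕ ℂ c`. -/
def complementCoord : Affine 𝔤 →ₗ[ℂ] ComplementIndex P →₀ ℂ :=
  (Module.Basis.ofVectorSpace ℂ (Affine 𝔤 ⧸ nilCentral P)).repr.toLinearMap ∘ₗ
    (nilCentral P).mkQ

theorem complementCoord_eq_zero {a : Affine 𝔤} :
    complementCoord P a = 0 ↔ a ∈ nilCentral P := by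
  simp [complementCoord]

theorem exists_complementCoord (y : ComplementIndex P) :
    ∃ x : Affine 𝔤, complementCoord P x = Finsupp.single y 1 := by
  obtain ⟨x, hx⟩ := (nilCentral P).mkQ_surjective
    (Module.Basis.ofVectorSpace ℂ (Affine 𝔤 ⧸ nilCentral P) y)
  refine ⟨x, ?_⟩
  rw [complementCoord, LinearMap.comp_apply, hx]
  exact (Module.Basis.ofVectorSpace ℂ (Affine 𝔤 ⧸ nilCentral P)).repr_self y

/-- The datum for the subalgebra `L(𝔫) ⊕ ℂ c` of `𝔤^`, its character given by `Λ` and `c ↦ θ`, and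
the deformation of this character in the direction given by `Λ'` and `c ↦ 0`. -/
def nilDatum {N : Type*} [AddCommGroup N] [Module ℂ N] (Λ Λ' : P.genRoots → ℤ → ℂ) (θ : ℂ)
    (ρ : Affine 𝔤 →ₗ[ℂ] N →ₗ[ℂ] N) (ρ_lie : ∀ g h w, ρ ⁅g, h⁆ w = ρ g (ρ h w) - ρ h (ρ g w))
    (v : N) (hv : ∀ f : Loop P.nil, ρ (P.loopNilIncl f) v = P.whittakerCharacter X Λ f • v)
    (hc : ρ Affine.central v = θ • v) :
    ExtensionDatum ℂ (Affine 𝔤) N (ComplementIndex P) where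
  e y := (exists_complementCoord P y).choose
  coord := complementCoord P
  coord_e y := (exists_complementCoord P y).choose_spec
  coord_lie a b ha hb := by
    rw [complementCoord_eq_zero, mem_nilCentral] at *
    obtain ⟨f, r, rfl⟩ := ha
    obtain ⟨g, s, rfl⟩ := hb
    exact ⟨⁅f, g⁆, 0, by rw [lie_nilCentral, zero_smul, add_zero]⟩
  ρ := ρ
  ρ_lie := ρ_lie
  χ := affineFunctional P X Λ θ
  μ := affineFunctional P X Λ' 0
  χ_lie a b ha hb := by
    rw [complementCoord_eq_zero, mem_nilCentral] at ha hb
    obtain ⟨f, r, rfl⟩ := ha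
    obtain ⟨g, s, rfl⟩ := hb
    rw [lie_nilCentral, affineFunctional_loopNilIncl, whittakerCharacter_lie]
  μ_lie a b ha hb := by
    rw [complementCoord_eq_zero, mem_nilCentral] at ha hb
    obtain ⟨f, r, rfl⟩ := ha
    obtain ⟨g, s, rfl⟩ := hb
    rw [lie_nilCentral, affineFunctional_loopNilIncl, whittakerCharacter_lie]
  v := v
  ρ_v a ha := by
    rw [complementCoord_eq_zero, mem_nilCentral] at ha
    obtain ⟨f, r, rfl⟩ := ha
    rw [map_add, map_smul, LinearMap.add_apply, LinearMap.smul_apply, hv, hc, map_add, map_smul,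
      affineFunctional_loopNilIncl, affineFunctional_central, smul_eq_mul]
    module

open ExtensionDatum

variable {N : Type*} [AddCommGroup N] [Module ℂ N] (Λ Λ' : P.genRoots → ℤ → ℂ) (θ : ℂ)
    (ρ : Affine 𝔤 →ₗ[ℂ] N →ₗ[ℂ] N) (ρ_lie : ∀ g h w, ρ ⁅g, h⁆ w = ρ g (ρ h w) - ρ h (ρ g w))
    (v : N) (hv : ∀ f : Loop P.nil, ρ (P.loopNilIncl f) v = P.whittakerCharacter X Λ f • v)
    (hc : ρ Affine.central v = θ • v)

theorem nilDatum_act_loopNilIncl (f : Loop P.nil) :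
    (nilDatum P X Λ Λ' θ ρ ρ_lie v hv hc).act (P.loopNilIncl f) (mon 0) =
      P.whittakerCharacter X Λ f • mon 0 + P.whittakerCharacter X Λ' f • incl ℂ _ v := by
  rw [act_zero _ ((complementCoord_eq_zero P).mpr (mem_nilCentral.mpr ⟨f, 0, by simp⟩))]
  change affineFunctional P X Λ θ _ • mon 0 + affineFunctional P X Λ' 0 _ • incl ℂ _ v = _
  rw [affineFunctional_loopNilIncl, affineFunctional_loopNilIncl]

theorem nilDatum_act_central :
    (nilDatum P X Λ Λ' θ ρ ρ_lie v hv hc).act Affine.central (mon 0) = θ • mon 0 := by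
  rw [act_zero _ ((complementCoord_eq_zero P).mpr (mem_nilCentral.mpr ⟨0, 1, by simp⟩))]
  change affineFunctional P X Λ θ _ • mon 0 + affineFunctional P X Λ' 0 _ • incl ℂ _ v = _
  rw [affineFunctional_central, affineFunctional_central, zero_smul, add_zero]

/-- The annihilator of the generator of `M(Λ, θ)` maps the generating vector `1` of `ℂ[Y] ⊕ N` into
`N`, as `1` has the defining properties of that generator modulo `N`. -/
theorem lift_rep_mem_range_incl (u : UniversalEnvelopingAlgebra ℂ (Affine 𝔤))
    (hu : u • genVec P X Λ θ = 0) :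
    UniversalEnvelopingAlgebra.lift ℂ (nilDatum P X Λ Λ' θ ρ ρ_lie v hv hc).rep u (mon 0) ∈
      LinearMap.range (incl ℂ (ComplementIndex P) : N →ₗ[ℂ] _) := by
  refine mem_of_smul_genVec_eq_zero P X Λ θ _ _ ?_ _ ?_ ?_ hu
  · intro u
    induction u using universalEnvelopingAlgebra_induction with
    | algebraMap r =>
      intro x hx
      rw [AlgHom.commutes]
      exact Submodule.smul_mem _ r hx
    | ι g =>
      rintro _ ⟨w, rfl⟩
      rw [UniversalEnvelopingAlgebra.lift_ι_apply]
      exact ⟨ρ g w, (act_inr (nilDatum P X Λ Λ' θ ρ ρ_lie v hv hc) g w).symm⟩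
    | mul a b ha hb =>
      intro x hx
      rw [map_mul]
      exact ha _ (hb _ hx)
    | add a b ha hb =>
      intro x hx
      rw [map_add]
      exact add_mem (ha _ hx) (hb _ hx)
  · rw [UniversalEnvelopingAlgebra.lift_ι_apply]
    have h1 := nilDatum_act_central P X Λ Λ' θ ρ ρ_lie v hv hc
    have h2 : (nilDatum P X Λ Λ' θ ρ ρ_lie v hv hc).rep Affine.central (mon 0) = θ • mon 0 := h1
    rw [h2, sub_self]
    exact zero_mem _
  · intro f
    rw [UniversalEnvelopingAlgebra.lift_ι_apply]
    have h1 := nilDatum_act_loopNilIncl P X Λ Λ' θ ρ ρ_lie v hv hc f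
    have h2 : (nilDatum P X Λ Λ' θ ρ ρ_lie v hv hc).rep (P.loopNilIncl f) (mon 0) = _ := h1
    rw [h2, add_sub_cancel_left]
    exact Submodule.smul_mem _ _ ⟨v, rfl⟩

/-- The extension datum with `N = 0` provides a nonzero vector with the defining properties of the
generator of `M(Λ, θ)`. -/
theorem genVec_ne_zero : genVec P X Λ θ ≠ 0 := by
  intro h
  have h1 := lift_rep_mem_range_incl P X Λ 0 θ (N := PUnit.{1}) 0 (fun _ _ _ => rfl) 0
    (fun _ => rfl) rfl 1 (by rw [h, smul_zero])
  rw [map_one] at h1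
  exact mon_notMem_range_incl _ h1

open ModuleCat in
attribute [local instance 100] LieRing.ofAssociativeRing in
/-- The homomorphism is `u ↦ u · 1 ∈ N` for the extension datum with `N = M(Λ, θ)`. -/
theorem exists_annIdeal_hom (α : P.genRoots) (μ : ℤ → ℂ) :
    ∃ f : annIdeal (inducedWhittaker P X Λ θ) (genVec P X Λ θ)
      →ₗ[UniversalEnvelopingAlgebra ℂ (Affine 𝔤)] inducedWhittaker P X Λ θ, ∀ (j : ℤ) (hj),
        f ⟨UniversalEnvelopingAlgebra.ι ℂ
          (P.loopNilIncl (loopElt ⟨X.vec α, α.2.1 _ (X.mem α)⟩ j)) - algebraMap ℂ _ (Λ α j), hj⟩ =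
          μ j • genVec P X Λ θ := by
  classical
  let M := inducedWhittaker P X Λ θ
  let σ : UniversalEnvelopingAlgebra ℂ (Affine 𝔤) →ₐ[ℂ] Module.End ℂ M := Algebra.lsmul ℂ ℂ M
  let ρ : Affine 𝔤 →ₗ[ℂ] M →ₗ[ℂ] M :=
    σ.toLinearMap ∘ₗ (UniversalEnvelopingAlgebra.ι ℂ (L := Affine 𝔤)).toLinearMap
  have hρ : ∀ g w, ρ g w = UniversalEnvelopingAlgebra.ι ℂ g • w := fun _ _ => rfl
  have ρ_lie : ∀ g h w, ρ ⁅g, h⁆ w = ρ g (ρ h w) - ρ h (ρ g w) := by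
    intro g h w
    rw [hρ, LieHom.map_lie, LieRing.of_associative_ring_bracket, sub_smul, mul_smul, mul_smul]
    rfl
  have hv : ∀ f : Loop P.nil, ρ (P.loopNilIncl f) (genVec P X Λ θ) =
      P.whittakerCharacter X Λ f • genVec P X Λ θ := by
    intro f
    have := nil_smul_genVec P X Λ θ f
    rw [sub_smul, sub_eq_zero, algebraMap_smul] at this
    exact this
  have hc : ρ Affine.central (genVec P X Λ θ) = θ • genVec P X Λ θ := by
    have := central_smul_genVec P X Λ θ
    rw [sub_smul, sub_eq_zero, algebraMap_smul] at this
    exact this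
  let Λ' : P.genRoots → ℤ → ℂ := fun β j => if β = α then μ j else 0
  let D := nilDatum P X Λ Λ' θ ρ ρ_lie (genVec P X Λ θ) hv hc
  let R := UniversalEnvelopingAlgebra.lift ℂ D.rep
  have hR : ∀ u (w : M), R u (incl ℂ _ w) = incl ℂ _ (u • w) := by
    intro u
    induction u using universalEnvelopingAlgebra_induction with
    | algebraMap r =>
      intro w
      rw [AlgHom.commutes, algebraMap_smul, map_smul]
      rfl
    | ι g =>
      intro w
      simp only [R]
      rw [UniversalEnvelopingAlgebra.lift_ι_apply]
      exact act_inr _ g w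
    | mul a b ha hb =>
      intro w
      rw [map_mul, Module.End.mul_apply, hb, ha, mul_smul]
    | add a b ha hb =>
      intro w
      rw [map_add, LinearMap.add_apply, hb, ha, add_smul, map_add]
  have hmem := lift_rep_mem_range_incl P X Λ Λ' θ ρ ρ_lie (genVec P X Λ θ) hv hc
  choose! f hf using hmem
  have hf' : ∀ u, u • genVec P X Λ θ = 0 → incl ℂ _ (f u) = R u (mon 0) := hf
  have hinj := incl_injective (k := ℂ) (N := M) (Y := ComplementIndex P)
  refine ⟨⟨⟨fun u => f u.1, fun u u' => hinj ?_⟩, fun a u => hinj ?_⟩, ?_⟩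
  · have h1 : (u + u').1 • genVec P X Λ θ = 0 := (u + u').2
    rw [map_add, hf' _ h1, hf' u.1 u.2, hf' u'.1 u'.2]
    change R (u.1 + u'.1) _ = _
    rw [map_add, LinearMap.add_apply]
  · have h1 : (a • u).1 • genVec P X Λ θ = 0 := (a • u).2
    change incl ℂ _ (f (a • u).1) = incl ℂ _ (a • f u.1)
    rw [← hR, hf' _ h1, hf' u.1 u.2]
    change R (a * u.1) _ = _
    rw [map_mul, Module.End.mul_apply]
  · intro j hj
    apply hinj
    refine (hf' (UniversalEnvelopingAlgebra.ι ℂ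
      (P.loopNilIncl (loopElt ⟨X.vec α, α.2.1 _ (X.mem α)⟩ j)) - algebraMap ℂ _ (Λ α j))
      hj).trans ?_
    have h1 := nilDatum_act_loopNilIncl P X Λ Λ' θ ρ ρ_lie (genVec P X Λ θ) hv hc
      (loopElt ⟨X.vec α, α.2.1 _ (X.mem α)⟩ j)
    rw [P.whittakerCharacter_rootVector, P.whittakerCharacter_rootVector] at h1
    have h2 : Λ' α j = μ j := if_pos rfl
    rw [h2] at h1
    rw [map_sub, LinearMap.sub_apply, AlgHom.commutes]
    simp only [R]
    rw [UniversalEnvelopingAlgebra.lift_ι_apply, map_smul]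
    have h3 : D.rep (P.loopNilIncl (loopElt ⟨X.vec α, α.2.1 _ (X.mem α)⟩ j)) (mon 0) = _ := h1
    rw [h3, Module.algebraMap_end_apply, add_sub_cancel_left]

end Extension

end AffineWhittaker
end

theorem corollary3p2 {𝔤 : Type u} [LieRing 𝔤] [LieAlgebra ℂ 𝔤] [FiniteDimensional ℂ 𝔤]
    [LieAlgebra.IsSemisimple ℂ 𝔤] (H : LieSubalgebra ℂ 𝔤) [H.IsCartanSubalgebra]
    (b : (LieAlgebra.IsKilling.rootSystem H).Base) (P : AffineWhittaker.Parabolic b)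
    (X : AffineWhittaker.RootVectors H) (Λ : P.genRoots → ℤ → ℂ)
    (hΛ : AffineWhittaker.StronglyGeneric Λ) (θ : ℂ) :
    Cardinal.aleph0 < Module.rank ℂ
      (CategoryTheory.Abelian.Ext.{u} (AffineWhittaker.inducedWhittaker P X Λ θ)
        (AffineWhittaker.inducedWhittaker P X Λ θ) 1) := by
  obtain ⟨α, hα⟩ := P.genRoots_nonempty X
  have hx : ∀ j : ℤ, _ • AffineWhittaker.genVec P X Λ θ = 0 := fun j =>
    AffineWhittaker.nil_smul_genVec P X Λ θ
      (AffineWhittaker.loopElt ⟨X.vec α, hα.1 _ (X.mem α)⟩ j)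
  refine AffineWhittaker.aleph0_lt_rank_ext
    (AffineWhittaker.rank_universalEnvelopingAlgebra_le (AffineWhittaker.rank_affine_le 𝔤))
    (AffineWhittaker.genVec_ne_zero P X Λ θ) (AffineWhittaker.exists_smul_genVec P X Λ θ)
    (fun j => ⟨_, hx j⟩) fun μ => ?_
  obtain ⟨f, hf⟩ := AffineWhittaker.exists_annIdeal_hom P X Λ θ ⟨α, hα⟩ μ
  refine ⟨f, fun j => ?_⟩
  rw [← hf j (by
    have := hx j
    rwa [P.whittakerCharacter_rootVector X Λ ⟨α, hα⟩ j] at this)]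
  congr 3
  rw [P.whittakerCharacter_rootVector X Λ ⟨α, hα⟩ j]
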